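/- Let $\mathcal X$ be an arbitrary nonempty set, let $\mathcal H_B$ be a finite-dimensional complex Hilbert space with set of density operators $\mathcal D(\mathcal H_B)$, and let $W:\mathcal X\to\mathcal D(\mathcal H_B)$ be an arbitrary map (a channel). For $n\in\mathbb N$ let $W^{\otimes n}:\mathcal X^n\to\mathcal D(\mathcal H_B^{\otimes n})$, $W^{\otimes n}(x_1,\dots,x_n):=W(x_1)\otimes\cdots\otimes W(x_n)$, be its memoryless extension. A code for $W^{\otimes n}$ is a triple $\mathcal C^{(n)}=(M_n,\varphi^{(n)},\Pi^{(n)})$ with $M_n\ge 1$ an integer, $\varphi^{(n)}:\{1,\dots,M_n\}\to\mathcal X^n$ a map, and $\Pi^{(n)}=\{\Pi^{(n)}_i\}_{i=1}^{M_n}$ a POVM on $\mathcal H_B^{\otimes n}$; its average error probability is $$p_e(\mathcal C^{(n)}):=\frac1{M_n}\sum_{i=1}^{M_n}\Big[1-\operatorname{Tr}\big(W^{\otimes n}(\varphi^{(n)}(i))\,\Pi^{(n)}_i\big)\Big].$$ The rate of a sequence of codes is $\liminf_{n\to\infty}\frac1n\log_2 M_n$. The direct capacity $C(W)$ is the supremum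 of the rates of all sequences of codes with $p_e(\mathcal C^{(n)})\to0$. The strong converse capacity $C^*(W)$ is the infimum of all real $R$ such that every sequence of codes with rate at least $R$ satisfies $p_e(\mathcal C^{(n)})\to1$. The Holevo capacity is $$\chi^*(W):=\sup_{p}\ \inf_{\sigma\in\mathcal D(\mathcal H_B)} D\big(\rho_{\mathcal XB}(p)\,\big\|\,\rho_{\mathcal X}(p)\otimes\sigma\big),$$ where $p$ runs over the finitely supported probability distributions on $\mathcal X$, $\rho_{\mathcal XB}(p)=\sum_x p(x)|x\rangle\langle x|\otimes W(x)$, $\rho_{\mathcal X}(p)=\sum_x p(x)|x\rangle\langle x|$ for orthonormal vectors $|x\rangle$, $x\in\mathcal X$, and $D(\rho\|\sigma)=\operatorname{Tr}\rho(\log_2\rho-\log_2\sigma)$ if $\operatorname{supp}\rho\subseteq\operatorname{supp}\sigma$ and $+\infty$ otherwise (logarithms taken on the supports). Then $$C(W)=C^*(W)=\chi^*(W).$$ -/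

import Mathlib

open scoped Kronecker ComplexOrder

noncomputable section

namespace CQ

/-- Density matrices (states) on the Hilbert space `ℂ^d`: positive semidefinite, unit trace. -/
structure State (d : Type*) [Fintype d] where
  mat : Matrix d d ℂ
  posSemidef : mat.PosSemidef
  trace_eq_one : mat.trace = 1

/-- A channel with input set `X` and output space `ℂ^d`: an arbitrary map from `X` to states. -/
abbrev Channel (X d : Type*) [Fintype d] := X → State d

/-! ### Product channels -/

/-- The tensor product `A 1 ⊗ ⋯ ⊗ A n`, a matrix on `(ℂ^d)^{⊗ n}`, whose standard basis is indexed
by the words `Fin n → d`. -/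
def tensorMat {d : Type*} {n : ℕ} (A : Fin n → Matrix d d ℂ) : Matrix (Fin n → d) (Fin n → d) ℂ :=
  Matrix.of fun i j => ∏ k, A k (i k) (j k)

theorem tensorMat_mul {d : Type*} [Fintype d] {n : ℕ} (A B : Fin n → Matrix d d ℂ) :
    tensorMat A * tensorMat B = tensorMat fun k => A k * B k := by
  classical
  ext i j
  simp only [tensorMat, Matrix.mul_apply, Matrix.of_apply, ← Finset.prod_mul_distrib]
  exact (Fintype.prod_sum fun k l => A k (i k) l * B k l (j k)).symm

theorem tensorMat_conjTranspose {d : Type*} {n : ℕ} (A : Fin n → Matrix d d ℂ) :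
    (tensorMat A).conjTranspose = tensorMat fun k => (A k).conjTranspose := by
  ext i j
  simp [tensorMat, Matrix.conjTranspose_apply]

theorem tensorMat_trace {d : Type*} [Fintype d] {n : ℕ} (A : Fin n → Matrix d d ℂ) :
    (tensorMat A).trace = ∏ k, (A k).trace := by
  classical
  simp only [tensorMat, Matrix.trace, Matrix.diag_apply, Matrix.of_apply]
  exact (Fintype.prod_sum fun k l => A k l l).symm

theorem tensorMat_posSemidef {d : Type*} [Fintype d] {n : ℕ} {A : Fin n → Matrix d d ℂ}
    (hA : ∀ k, (A k).PosSemidef) : (tensorMat A).PosSemidef := by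
  classical
  have h : ∀ k, ∃ B : Matrix d d ℂ, A k = B.conjTranspose * B := fun k => by
    open scoped MatrixOrder in
    exact CStarAlgebra.nonneg_iff_eq_star_mul_self.mp (hA k).nonneg
  choose B hB using h
  have : tensorMat A = (tensorMat B).conjTranspose * tensorMat B := by
    rw [tensorMat_conjTranspose, tensorMat_mul]
    congr 1
    funext k
    exact hB k
  rw [this]
  exact Matrix.posSemidef_conjTranspose_mul_self _

/-- The product state `ρ 1 ⊗ ⋯ ⊗ ρ n`. -/
def State.tensor {d : Type*} [Fintype d] {n : ℕ} (ρ : Fin n → State d) : State (Fin n → d) where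
  mat := tensorMat fun k => (ρ k).mat
  posSemidef := tensorMat_posSemidef fun k => (ρ k).posSemidef
  trace_eq_one := by simp [tensorMat_trace, State.trace_eq_one]

/-- The memoryless extension: `W^{⊗ n}(x 1, …, x n) = W(x 1) ⊗ ⋯ ⊗ W(x n)` on the input set `X^n`. -/
def Channel.memoryless {X d : Type*} [Fintype d] (W : Channel X d) (n : ℕ) :
    Channel (Fin n → X) (Fin n → d) :=
  fun x => State.tensor fun k => W (x k)

/-! ### Codes and capacities -/

/-- A code for a channel with input set `X` and output space `ℂ^d`: a number `M ≥ 1` of messages,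
an encoding, and a decoding POVM. -/
structure Code (X d : Type*) [Fintype d] [DecidableEq d] where
  M : ℕ
  M_pos : 0 < M
  enc : Fin M → X
  povm : Fin M → Matrix d d ℂ
  povm_posSemidef : ∀ i, (povm i).PosSemidef
  povm_sum : ∑ i, povm i = 1

/-- The average error probability of a code. -/
def Code.avgError {X d : Type*} [Fintype d] [DecidableEq d] (c : Code X d) (W : Channel X d) : ℝ :=
  (1 / (c.M : ℝ)) * ∑ i, (1 - ((W (c.enc i)).mat * c.povm i).trace.re)

/-- The rate `liminf_n (1/n) log₂ M_n` of a sequence of codes. -/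
def codeRate {X d : ℕ → Type*} [∀ n, Fintype (d n)] [∀ n, DecidableEq (d n)]
    (c : ∀ n, Code (X n) (d n)) : EReal :=
  Filter.liminf (fun n : ℕ => (((1 / (n : ℝ)) * Real.logb 2 ((c n).M : ℝ) : ℝ) : EReal)) Filter.atTop

/-- The (direct) capacity of a sequence of channels: the supremum of the rates of all sequences of
codes whose error probabilities tend to `0`. -/
def capacity {X d : ℕ → Type*} [∀ n, Fintype (d n)] [∀ n, DecidableEq (d n)]
    (W : ∀ n, Channel (X n) (d n)) : EReal :=
  sSup {R : EReal | ∃ c : ∀ n, Code (X n) (d n),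
    Filter.Tendsto (fun n => (c n).avgError (W n)) Filter.atTop (nhds 0) ∧ R = codeRate c}

/-- The strong converse capacity of a sequence of channels: the infimum of the real numbers `R` such
that every sequence of codes with rate at least `R` has error probabilities tending to `1`. -/
def strongConverseCapacity {X d : ℕ → Type*} [∀ n, Fintype (d n)] [∀ n, DecidableEq (d n)]
    (W : ∀ n, Channel (X n) (d n)) : EReal :=
  sInf ((fun R : ℝ => (R : EReal)) '' {R : ℝ | ∀ c : ∀ n, Code (X n) (d n), (R : EReal) ≤ codeRate c →
    Filter.Tendsto (fun n => (c n).avgError (W n)) Filter.atTop (nhds 1)})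

/-! ### Relative entropy and the Holevo capacity -/

/-- The relative entropy `Tr ρ (log₂ ρ - log₂ σ)` of positive semidefinite matrices if
`supp ρ ⊆ supp σ` (the support of a Hermitian matrix is its range), and `+∞` otherwise. Since
`Real.logb 2 0 = 0`, the functional calculus gives the logarithm on the support. -/
def relEntropy {ι : Type*} [Fintype ι] [DecidableEq ι] (ρ σ : Matrix ι ι ℂ) : EReal :=
  open Classical in
  if LinearMap.range ρ.mulVecLin ≤ LinearMap.range σ.mulVecLin then
    (((ρ * (cfc (Real.logb 2) ρ - cfc (Real.logb 2) σ)).trace.re : ℝ) : EReal)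
  else ⊤

/-- Finitely supported probability distributions on a set. -/
structure FinDist (X : Type*) where
  prob : X →₀ ℝ
  nonneg : ∀ x, 0 ≤ prob x
  sum_eq_one : ∑ x ∈ prob.support, prob x = 1

open Classical in
/-- The state `ρ_X(p) = ∑ p(x) |x⟩⟨x|`, on the span of the basis vectors `|x⟩` with `p(x) > 0`. -/
def FinDist.inputState {X : Type*} (p : FinDist X) : Matrix p.prob.support p.prob.support ℂ :=
  ∑ x : p.prob.support, (p.prob x : ℂ) • Matrix.single x x 1

open Classical in
/-- The classical-quantum state `ρ_XB(p) = ∑ p(x) |x⟩⟨x| ⊗ W(x)`, on the tensor product of the span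
of the basis vectors `|x⟩` with `p(x) > 0` and the output space. -/
def Channel.cqState {X d : Type*} [Fintype d] (W : Channel X d) (p : FinDist X) :
    Matrix (p.prob.support × d) (p.prob.support × d) ℂ :=
  ∑ x : p.prob.support, (p.prob x : ℂ) • (Matrix.single x x 1 ⊗ₖ (W x).mat)

open Classical in
/-- `χ(W, p) = inf_σ D(ρ_XB(p) ‖ ρ_X(p) ⊗ σ)`, over all states `σ` of the output system. -/
def Channel.holevoQuantity {X d : Type*} [Fintype d] [DecidableEq d] (W : Channel X d)
    (p : FinDist X) : EReal :=
  ⨅ σ : State d, relEntropy (W.cqState p) (p.inputState ⊗ₖ σ.mat)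

/-- The Holevo capacity `χ*(W) = sup_p χ(W, p)`. -/
def Channel.holevoCapacity {X d : Type*} [Fintype d] [DecidableEq d] (W : Channel X d) : EReal :=
  ⨆ p : FinDist X, W.holevoQuantity p

end CQ

end

/-! The proof runs in nats through three inequalities: the direct capacity is at most the strong
converse capacity, which is at most the Holevo capacity, which is at most the direct capacity. The
first holds because an error cannot tend to both `0` and `1`. By Klein's inequality the infimum over
`σ` is attained at the average output state, so each Holevo quantity is the finite number
`holevoInfo p / log 2` (`holevoQuantity_eq`).

Two states `U diag(a) Uᴴ` and `V diag(b) Vᴴ` are compared through the classical weights `a i *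
overlap U V i j`. They form a probability distribution, `Tr ρ (log ρ - log σ)` is the mean of `log
(a i) - log (b j)` under it (given support inclusion), and under tensor products they become product
distributions (`overlap_tensorMat`). The asymptotics thus reduce to exponential estimates for sums
of independent real variables.

Strong converse: some full-rank `σ` lies within divergence `χ + γ` of every output
(`exists_center`). It is found by moving a near-optimal input distribution slightly towards a letter
`x`: the Holevo information cannot rise above `χ`, which bounds the divergence of `W x`. For a code,
each POVM element is a test of its codeword against `σ^{⊗ n}`. `trace_tensor_mul_le` bounds the
acceptance probability of a codeword by a small term plus `a` times that of `σ^{⊗ n}`. The latter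
probabilities sum to `1` over the messages, so the success probability is at most a small term plus
`a / M`, uniformly over all codewords.

Direct part: for a distribution `p`, the test `P Q P` combines the small eigenvalues of the average
state (`P`) with the large eigenvalues of the codeword state (`Q`). It accepts random codeword
states with probability tending to `1`, and the average state with probability at most `exp (-n r)`
for any `r` below the Holevo information (`exists_tests`). Random codewords, the pretty good
measurement and the Hayashi–Nagaoka inequality convert these tests into codes
(`exists_code_of_average`). -/

namespace CQ

open Matrix

/-! ### Spectral decompositions -/

section Overlap

variable {ι : Type*} [Fintype ι]

/-- The squared moduli of the entries of `Uᴴ V`. -/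
noncomputable def overlap (U V : Matrix ι ι ℂ) (i j : ι) : ℝ := Complex.normSq ((Uᴴ * V) i j)

theorem overlap_nonneg (U V : Matrix ι ι ℂ) (i j : ι) : 0 ≤ overlap U V i j :=
  Complex.normSq_nonneg _

theorem overlap_comm (U V : Matrix ι ι ℂ) (i j : ι) : overlap U V i j = overlap V U j i := by
  have : (Uᴴ * V) i j = star ((Vᴴ * U) j i) := by
    rw [← conjTranspose_apply, conjTranspose_mul, conjTranspose_conjTranspose]
  simp [overlap, this, Complex.normSq_conj]

end Overlap

section Spectral

variable {ι : Type*} [Fintype ι] [DecidableEq ι]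

/-- The matrix `U diag(a) Uᴴ`. -/
noncomputable def conjDiag (U : Matrix ι ι ℂ) (a : ι → ℝ) : Matrix ι ι ℂ :=
  U * diagonal (fun i => (a i : ℂ)) * Uᴴ

theorem overlap_self {U : Matrix ι ι ℂ} (hU : Uᴴ * U = 1) (i j : ι) :
    overlap U U i j = if i = j then 1 else 0 := by
  rw [overlap, hU, one_apply]; split_ifs <;> simp

/-- `Uᴴ V` is unitary, so its rows are unit vectors; with `overlap_comm` the overlaps form a doubly
stochastic matrix. -/
theorem sum_overlap {U V : Matrix ι ι ℂ} (hU : Uᴴ * U = 1) (hV : V * Vᴴ = 1) (i : ι) :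
    ∑ j, overlap U V i j = 1 := by
  have h : ((Uᴴ * V) * (Uᴴ * V)ᴴ) i i = 1 := by
    rw [conjTranspose_mul, conjTranspose_conjTranspose, Matrix.mul_assoc, ← Matrix.mul_assoc V, hV,
      Matrix.one_mul, hU, one_apply_eq]
  rw [mul_apply] at h
  have h2 := congrArg Complex.re h
  simpa [conjTranspose_apply, Complex.mul_conj, overlap] using h2

theorem trace_conjDiag_mul (U : Matrix ι ι ℂ) (a : ι → ℝ) (A : Matrix ι ι ℂ) :
    (conjDiag U a * A).trace.re = ∑ i, a i * ((Uᴴ * A * U) i i).re := by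
  rw [conjDiag, Matrix.mul_assoc, Matrix.mul_assoc, trace_mul_comm, Matrix.mul_assoc]
  simp [trace, diagonal_mul]

theorem trace_conjDiag_mul_sandwich (U V : Matrix ι ι ℂ) (a b : ι → ℝ) (S : Matrix ι ι ℂ) :
    (conjDiag U a * (S * conjDiag V b * Sᴴ)).trace.re
      = ∑ i, ∑ j, a i * (b j * Complex.normSq ((Uᴴ * S * V) i j)) := by
  rw [trace_conjDiag_mul]
  refine Finset.sum_congr rfl fun i _ => ?_
  have h : Uᴴ * (S * conjDiag V b * Sᴴ) * U
      = (Uᴴ * S * V) * diagonal (fun j => (b j : ℂ)) * (Uᴴ * S * V)ᴴ := by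
    simp only [conjDiag, conjTranspose_mul, conjTranspose_conjTranspose, Matrix.mul_assoc]
  rw [h, mul_apply, Complex.re_sum, Finset.mul_sum]
  refine Finset.sum_congr rfl fun j _ => ?_
  rw [mul_diagonal, conjTranspose_apply, Complex.star_def, mul_comm _ (b j : ℂ), mul_assoc,
    Complex.mul_conj, Complex.re_ofReal_mul, Complex.ofReal_re]

theorem trace_conjDiag_mul_conjDiag (U V : Matrix ι ι ℂ) (a b : ι → ℝ) :
    (conjDiag U a * conjDiag V b).trace.re = ∑ i, ∑ j, a i * (b j * overlap U V i j) := by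
  simpa [overlap] using trace_conjDiag_mul_sandwich U V a b 1

theorem conjDiag_one {U : Matrix ι ι ℂ} (hU : U * Uᴴ = 1) : conjDiag U (fun _ => 1) = 1 := by
  simp [conjDiag, hU]

theorem conjDiag_add (U : Matrix ι ι ℂ) (a b : ι → ℝ) :
    conjDiag U a + conjDiag U b = conjDiag U (fun i => a i + b i) := by
  simp only [conjDiag, ← Matrix.add_mul, ← Matrix.mul_add, diagonal_add, Complex.ofReal_add]

theorem conjDiag_sub (U : Matrix ι ι ℂ) (a b : ι → ℝ) :
    conjDiag U a - conjDiag U b = conjDiag U (fun i => a i - b i) := by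
  simp only [conjDiag, ← Matrix.sub_mul, ← Matrix.mul_sub, diagonal_sub, Complex.ofReal_sub]

theorem conjDiag_smul (U : Matrix ι ι ℂ) (c : ℝ) (a : ι → ℝ) :
    (c : ℂ) • conjDiag U a = conjDiag U (fun i => c * a i) := by
  have : diagonal (fun i => ((c * a i : ℝ) : ℂ)) = (c : ℂ) • diagonal (fun i => (a i : ℂ)) := by
    rw [← diagonal_smul]; congr 1; ext i; simp
  simp only [conjDiag, this, Matrix.mul_smul, Matrix.smul_mul]

theorem conjDiag_mul {U : Matrix ι ι ℂ} (hU : Uᴴ * U = 1) (a b : ι → ℝ) :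
    conjDiag U a * conjDiag U b = conjDiag U (fun i => a i * b i) := by
  have : conjDiag U a * conjDiag U b = U * (diagonal (fun i => (a i : ℂ)) * ((Uᴴ * U) *
      diagonal (fun i => (b i : ℂ)))) * Uᴴ := by
    simp only [conjDiag, Matrix.mul_assoc]
  rw [this, hU, Matrix.one_mul, diagonal_mul_diagonal]
  simp [conjDiag]

theorem conjDiag_isHermitian (U : Matrix ι ι ℂ) (a : ι → ℝ) : (conjDiag U a).IsHermitian := by
  simp only [IsHermitian, conjDiag, conjTranspose_mul, conjTranspose_conjTranspose,
    diagonal_conjTranspose, Matrix.mul_assoc]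
  congr 3
  ext i; simp

theorem conjDiag_posSemidef (U : Matrix ι ι ℂ) {a : ι → ℝ} (ha : ∀ i, 0 ≤ a i) :
    (conjDiag U a).PosSemidef :=
  (PosSemidef.diagonal fun i => by
    simpa using ha i).mul_mul_conjTranspose_same U

theorem trace_conjDiag {U : Matrix ι ι ℂ} (hU : Uᴴ * U = 1) (a : ι → ℝ) :
    (conjDiag U a).trace = ∑ i, (a i : ℂ) := by
  rw [conjDiag, trace_mul_cycle, hU, Matrix.one_mul, trace_diagonal]

theorem exists_conjDiag {A : Matrix ι ι ℂ} (hA : A.PosSemidef) :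
    ∃ (U : Matrix ι ι ℂ) (a : ι → ℝ), Uᴴ * U = 1 ∧ U * Uᴴ = 1 ∧ (∀ i, 0 ≤ a i) ∧
      A = conjDiag U a := by
  refine ⟨hA.isHermitian.eigenvectorUnitary, hA.isHermitian.eigenvalues, ?_, ?_,
    hA.eigenvalues_nonneg, ?_⟩
  · exact Unitary.coe_star_mul_self _
  · exact Unitary.coe_mul_star_self _
  · have := hA.isHermitian.spectral_theorem
    rw [Unitary.conjStarAlgAut_apply] at this
    exact this

/-- Conjugation of real diagonal matrices by a unitary, as an algebra homomorphism. -/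
noncomputable def conjDiagHom {U : Matrix ι ι ℂ} (hU : Uᴴ * U = 1) (hU' : U * Uᴴ = 1) :
    (ι → ℝ) →ₐ[ℝ] Matrix ι ι ℂ :=
  AlgHom.ofLinearMap
    { toFun := conjDiag U
      map_add' := fun a b => (conjDiag_add U a b).symm
      map_smul' := fun c a => by
        rw [RingHom.id_apply, ← Complex.coe_smul, conjDiag_smul]; rfl }
    (conjDiag_one hU') (fun a b => (conjDiag_mul hU a b).symm)

/-- The spectrum is finite, so `f` may be replaced by its Lagrange interpolant at the numbers `a i`;
polynomials commute with the algebra homomorphism `conjDiagHom`. -/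
theorem cfc_conjDiag {U : Matrix ι ι ℂ} (hU : Uᴴ * U = 1) (hU' : U * Uᴴ = 1) (f : ℝ → ℝ)
    (a : ι → ℝ) : cfc f (conjDiag U a) = conjDiag U (fun i => f (a i)) := by
  set q : Polynomial ℝ := Lagrange.interpolate (Finset.univ.image a) id f
  have hq : ∀ i, q.eval (a i) = f (a i) := fun i =>
    Lagrange.eval_interpolate_at_node f Function.injective_id.injOn
      (Finset.mem_image_of_mem a (Finset.mem_univ i))
  have hspec : (spectrum ℝ (conjDiag U a)) ⊆ Set.range a := by
    have h1 : spectrum ℝ (conjDiag U a) ⊆ spectrum ℝ a :=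
      AlgHom.spectrum_apply_subset (conjDiagHom hU hU') a
    refine h1.trans fun x hx => ?_
    by_contra hne
    refine hx ?_
    rw [spectrum.mem_resolventSet_iff, Pi.isUnit_iff]
    intro i
    have : x - a i ≠ 0 := fun h => hne ⟨i, by linarith⟩
    simpa using this
  have h1 : cfc f (conjDiag U a) = cfc (fun x => q.eval x) (conjDiag U a) := by
    refine cfc_congr fun x hx => ?_
    obtain ⟨i, rfl⟩ := hspec hx
    exact (hq i).symm
  rw [h1, cfc_polynomial q _ (conjDiag_isHermitian U a).isSelfAdjoint]
  have h2 := Polynomial.aeval_algHom_apply (conjDiagHom hU hU') a q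
  refine h2.trans ?_
  change conjDiag U _ = _
  congr 1
  ext i
  rw [← hq i]
  simp

theorem re_trace_mul_nonneg {A B : Matrix ι ι ℂ} (hA : A.PosSemidef) (hB : B.PosSemidef) :
    0 ≤ (A * B).trace.re := by
  obtain ⟨U, a, -, -, ha, rfl⟩ := exists_conjDiag hA
  obtain ⟨V, b, -, -, hb, rfl⟩ := exists_conjDiag hB
  rw [trace_conjDiag_mul_conjDiag]
  exact Finset.sum_nonneg fun i _ => Finset.sum_nonneg fun j _ =>
    mul_nonneg (ha i) (mul_nonneg (hb j) (overlap_nonneg _ _ _ _))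

theorem nonneg_of_conjDiag_posSemidef {U : Matrix ι ι ℂ} (hU : Uᴴ * U = 1) {a : ι → ℝ}
    (h : (conjDiag U a).PosSemidef) (i : ι) : 0 ≤ a i := by
  have h1 := (h.conjTranspose_mul_mul_same U).diag_nonneg (i := i)
  have h2 : Uᴴ * conjDiag U a * U = (Uᴴ * U) * diagonal (fun i => (a i : ℂ)) * (Uᴴ * U) := by
    simp only [conjDiag, Matrix.mul_assoc]
  rw [h2, hU, Matrix.one_mul, Matrix.mul_one, diagonal_apply_eq] at h1
  exact_mod_cast h1

theorem posSemidef_sub_mul_self {T : Matrix ι ι ℂ} (hT : T.PosSemidef)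
    (hT' : (1 - T).PosSemidef) : (T - T * T).PosSemidef := by
  obtain ⟨U, a, hU, hU', ha, rfl⟩ := exists_conjDiag hT
  have key : ∀ i, a i ≤ 1 := fun i => by
    rw [← conjDiag_one hU', conjDiag_sub] at hT'
    linarith [nonneg_of_conjDiag_posSemidef hU hT' i]
  rw [conjDiag_mul hU, conjDiag_sub]
  exact conjDiag_posSemidef U fun i => by nlinarith [ha i, key i]

theorem cfc_log_le_cfc_log {A B : Matrix ι ι ℂ} (hA : A.PosDef) (h : (B - A).PosSemidef) :
    (cfc Real.log B - cfc Real.log A).PosSemidef := by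
  open scoped Matrix.Norms.L2Operator MatrixOrder in
  have : IsStrictlyPositive A := hA.isStrictlyPositive
  exact Matrix.le_iff.1 (CFC.log_le_log (Matrix.le_iff.2 h) this)

end Spectral

/-! ### Tensor products of spectral decompositions -/

section Tensor

variable {d : Type*} [Fintype d] [DecidableEq d] {n : ℕ}

theorem tensorMat_one : tensorMat (fun _ : Fin n => (1 : Matrix d d ℂ)) = 1 := by
  ext i j
  rw [tensorMat, of_apply, one_apply]
  split_ifs with h
  · exact Finset.prod_eq_one fun k _ => by rw [h, one_apply_eq]
  · obtain ⟨k, hk⟩ := Function.ne_iff.1 h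
    exact Finset.prod_eq_zero (Finset.mem_univ k) (one_apply_ne hk)

theorem tensorMat_diagonal {d : Type*} [DecidableEq d] (a : Fin n → d → ℝ) :
    tensorMat (fun k => diagonal fun i => (a k i : ℂ))
      = diagonal fun w : Fin n → d => ((∏ k, a k (w k) : ℝ) : ℂ) := by
  ext i j
  rw [tensorMat, of_apply, diagonal_apply]
  split_ifs with h
  · simp [h]
  · obtain ⟨k, hk⟩ := Function.ne_iff.1 h
    exact Finset.prod_eq_zero (Finset.mem_univ k) (diagonal_apply_ne _ hk)

theorem tensorMat_conjDiag (U : Fin n → Matrix d d ℂ) (a : Fin n → d → ℝ) :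
    tensorMat (fun k => conjDiag (U k) (a k))
      = conjDiag (tensorMat U) fun w => ∏ k, a k (w k) := by
  simp only [conjDiag]
  rw [← tensorMat_diagonal, tensorMat_conjTranspose, tensorMat_mul, tensorMat_mul]

theorem tensorMat_conjTranspose_mul_self {U : Fin n → Matrix d d ℂ}
    (hU : ∀ k, (U k)ᴴ * U k = 1) : (tensorMat U)ᴴ * tensorMat U = 1 := by
  rw [tensorMat_conjTranspose, tensorMat_mul]
  simp only [hU, tensorMat_one]

theorem tensorMat_mul_conjTranspose_self {U : Fin n → Matrix d d ℂ}
    (hU : ∀ k, U k * (U k)ᴴ = 1) : tensorMat U * (tensorMat U)ᴴ = 1 := by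
  rw [tensorMat_conjTranspose, tensorMat_mul]
  simp only [hU, tensorMat_one]

/-- This factorization turns spectral comparison of product states into a statement about
independent variables. -/
theorem overlap_tensorMat {d : Type*} [Fintype d] (U V : Fin n → Matrix d d ℂ) (i j : Fin n → d) :
    overlap (tensorMat U) (tensorMat V) i j = ∏ k, overlap (U k) (V k) (i k) (j k) := by
  rw [overlap, tensorMat_conjTranspose, tensorMat_mul, tensorMat, of_apply, map_prod]
  rfl

end Tensor

theorem sum_sum_prod_eq_prod_sum_sum {d e : Type*} [Fintype d] [Fintype e] {n : ℕ}
    (F : Fin n → d → e → ℝ) :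
    ∑ i : Fin n → d, ∑ j : Fin n → e, ∏ k, F k (i k) (j k) = ∏ k, ∑ i, ∑ j, F k i j := by
  classical
  rw [Fintype.prod_sum]
  exact Finset.sum_congr rfl fun i _ => (Fintype.prod_sum fun k j => F k (i k) j).symm

/-! ### The strong converse -/

section Test

variable {ι : Type*} [Fintype ι] [DecidableEq ι]

/-- Weighted Cauchy–Schwarz: the difference of the two sides is `|ε x - y|²`. -/
theorem normSq_add_le_weighted (ε : ℝ) (x y : ℂ) :
    ε * Complex.normSq (x + y) ≤ (1 + ε) * (ε * Complex.normSq x + Complex.normSq y) := by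
  simp only [Complex.normSq_apply, Complex.add_re, Complex.add_im]
  nlinarith [sq_nonneg (ε * x.re - y.re), sq_nonneg (ε * x.im - y.im)]

/-- A bound on the success probability of a test, by the joint distribution of the spectra. -/
theorem trace_mul_le_of_overlap {U V : Matrix ι ι ℂ} {a b : ι → ℝ} (hU : Uᴴ * U = 1)
    (hV : V * Vᴴ = 1) (hU' : U * Uᴴ = 1) (ha : ∀ i, 0 ≤ a i)
    (ha1 : ∑ i, a i = 1) (hb : ∀ i, 0 ≤ b i) {T : Matrix ι ι ℂ} (hT : T.PosSemidef)
    (hT' : (1 - T).PosSemidef) {ε c : ℝ} (hε : 0 < ε) (hc : 0 ≤ c) :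
    (conjDiag U a * T).trace.re
      ≤ ε + (∑ i, ∑ j, if a i ≤ ε * c * b j then 0 else a i * overlap U V i j)
        + c * (conjDiag V b * T).trace.re := by
  set X := (conjDiag U a * T).trace.re
  set Y := (conjDiag V b * T).trace.re
  set bad := ∑ i, ∑ j, if a i ≤ ε * c * b j then 0 else a i * overlap U V i j
  have hρ := conjDiag_posSemidef U ha
  have hσ := conjDiag_posSemidef V hb
  have hX0 : 0 ≤ X := re_trace_mul_nonneg hρ hT
  have hY0 : 0 ≤ Y := re_trace_mul_nonneg hσ hT
  have htr : (conjDiag U a).trace.re = 1 := by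
    rw [trace_conjDiag hU, Complex.re_sum]; simpa using ha1
  -- The left side is `Tr ρ (1 - T)²`, and `(1 - T)² ≤ 1 - T`. In the same way `h2` rests on `T² ≤
  -- T`.
  have h1 : ∑ i, ∑ j, a i * Complex.normSq ((Uᴴ * (1 - T) * V) i j) ≤ 1 - X := by
    have e := trace_conjDiag_mul_sandwich U V a (fun _ => 1) (1 - T)
    rw [conjDiag_one hV, Matrix.mul_one, hT'.isHermitian.eq] at e
    simp only [one_mul] at e
    rw [← e]
    have := re_trace_mul_nonneg hρ (posSemidef_sub_mul_self hT' (by simpa using hT))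
    rw [Matrix.mul_sub, trace_sub, Complex.sub_re, Matrix.mul_sub, Matrix.mul_one, trace_sub,
      Complex.sub_re, htr] at this
    linarith
  have h2 : ∑ i, ∑ j, b j * Complex.normSq ((Uᴴ * T * V) i j) ≤ Y := by
    have e := trace_conjDiag_mul_sandwich V U b (fun _ => 1) T
    rw [conjDiag_one hU', Matrix.mul_one, hT.isHermitian.eq] at e
    simp only [one_mul] at e
    have := re_trace_mul_nonneg hσ (posSemidef_sub_mul_self hT hT')
    rw [Matrix.mul_sub, trace_sub, Complex.sub_re, e, Finset.sum_comm] at this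
    refine le_trans (le_of_eq ?_) (sub_nonneg.1 this)
    refine Finset.sum_congr rfl fun i _ => Finset.sum_congr rfl fun j _ => ?_
    have : (Uᴴ * T * V) i j = star ((Vᴴ * T * U) j i) := by
      rw [← conjTranspose_apply]
      simp only [conjTranspose_mul, conjTranspose_conjTranspose, hT.isHermitian.eq,
        Matrix.mul_assoc]
    rw [this, Complex.star_def, Complex.normSq_conj]
  have h3 : ∀ i j, a i * overlap U V i j
      ≤ (1 + ε) * (a i * Complex.normSq ((Uᴴ * (1 - T) * V) i j)
          + c * (b j * Complex.normSq ((Uᴴ * T * V) i j)))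
        + if a i ≤ ε * c * b j then 0 else a i * overlap U V i j := by
    intro i j
    have p1 := mul_nonneg (ha i) (Complex.normSq_nonneg ((Uᴴ * (1 - T) * V) i j))
    have p2 := mul_nonneg hc (mul_nonneg (hb j) (Complex.normSq_nonneg ((Uᴴ * T * V) i j)))
    split_ifs with h
    -- Splitting the amplitude as `⟨u|(1 - T)|v⟩ + ⟨u|T|v⟩` costs a factor `1/ε` on the second part;
    -- the likelihood bound `a i ≤ ε c b j` absorbs it and changes the weight from `a i` to `c b j`.
    · have e : (Uᴴ * V) i j = (Uᴴ * (1 - T) * V) i j + (Uᴴ * T * V) i j := by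
        rw [← Matrix.add_apply, ← Matrix.add_mul, ← Matrix.mul_add, sub_add_cancel, Matrix.mul_one]
      have e2 := normSq_add_le_weighted ε ((Uᴴ * (1 - T) * V) i j) ((Uᴴ * T * V) i j)
      rw [← e] at e2
      have e3 := mul_le_mul_of_nonneg_left e2 (ha i)
      have e4 := mul_le_mul_of_nonneg_right h (Complex.normSq_nonneg ((Uᴴ * T * V) i j))
      refine le_of_mul_le_mul_left ?_ hε
      rw [overlap]
      nlinarith
    · nlinarith
  have h4 : ∑ i, ∑ j, a i * overlap U V i j = 1 := by
    simp only [← Finset.mul_sum, sum_overlap hU hV, mul_one, ha1]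
  have h5 : 1 ≤ (1 + ε) * ((1 - X) + c * Y) + bad := by
    calc 1 = ∑ i, ∑ j, a i * overlap U V i j := h4.symm
      _ ≤ ∑ i, ∑ j, ((1 + ε) * (a i * Complex.normSq ((Uᴴ * (1 - T) * V) i j)
          + c * (b j * Complex.normSq ((Uᴴ * T * V) i j)))
        + if a i ≤ ε * c * b j then 0 else a i * overlap U V i j) :=
          Finset.sum_le_sum fun i _ => Finset.sum_le_sum fun j _ => h3 i j
      _ = (1 + ε) * ((∑ i, ∑ j, a i * Complex.normSq ((Uᴴ * (1 - T) * V) i j))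
          + c * ∑ i, ∑ j, b j * Complex.normSq ((Uᴴ * T * V) i j)) + bad := by
          simp only [Finset.sum_add_distrib, Finset.mul_sum, mul_add, bad]
      _ ≤ _ := by
          gcongr
  have hbad : 0 ≤ bad := Finset.sum_nonneg fun i _ => Finset.sum_nonneg fun j _ => by
    split_ifs
    · exact le_rfl
    · exact mul_nonneg (ha i) (overlap_nonneg _ _ _ _)
  by_contra hcon
  push Not at hcon
  nlinarith [mul_nonneg hε.le hbad, mul_nonneg hε.le hX0, mul_nonneg hc hY0]

end Test

theorem exp_le_one_add_add_sq {y : ℝ} (hy : y ≤ 1) : Real.exp y ≤ 1 + y + y ^ 2 := by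
  by_cases h : -1 ≤ y
  · have := (abs_le.1 (Real.abs_exp_sub_one_sub_id_le (abs_le.2 ⟨h, hy⟩))).2
    linarith
  · have := Real.exp_le_one_iff.2 (show y ≤ 0 by linarith)
    nlinarith

/-- This is the square of `|√a log √a| ≤ 1`. It bounds second moments of `log a` without a lower
bound on the eigenvalues `a`. -/
theorem mul_sq_log_le {a : ℝ} (h0 : 0 ≤ a) (h1 : a ≤ 1) : a * Real.log a ^ 2 ≤ 4 := by
  rcases h0.eq_or_lt with rfl | h0
  · simp
  have hs : 0 < √a := Real.sqrt_pos.2 h0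
  have h := Real.abs_log_mul_self_lt (√a) hs (Real.sqrt_le_one.2 h1)
  have h2 : (Real.log √a * √a) ^ 2 ≤ 1 := by
    rw [← sq_abs]; exact pow_le_one₀ (abs_nonneg _) h.le
  rw [Real.log_sqrt h0.le, mul_pow, Real.sq_sqrt h0.le] at h2
  linarith

/-! ### Moment generating function of the log-likelihood ratio for one letter. -/

section Letter

variable {ι : Type*} [Fintype ι] [DecidableEq ι]

/-- A bound on the moment generating function of the log-likelihood ratio of the spectra. -/
theorem sum_overlap_exp_le {U V : Matrix ι ι ℂ} {a b : ι → ℝ} (hU : Uᴴ * U = 1)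
    (hV : V * Vᴴ = 1) (ha : ∀ i, 0 ≤ a i) (ha1 : ∑ i, a i = 1)
    {β : ℝ} (hβ : 0 < β) (hb : ∀ i, β ≤ b i) (hb1 : ∀ i, b i ≤ 1) {s : ℝ} (hs : 0 ≤ s)
    (hsβ : s * -Real.log β ≤ 1) :
    ∑ i, ∑ j, a i * overlap U V i j * Real.exp (s * (Real.log (a i) - Real.log (b j)))
      ≤ Real.exp (s * (∑ i, ∑ j, a i * overlap U V i j * (Real.log (a i) - Real.log (b j)))
          + s ^ 2 * (8 * Fintype.card ι + 2 * Real.log β ^ 2)) := by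
  have ha1' : ∀ i, a i ≤ 1 := fun i =>
    ha1 ▸ Finset.single_le_sum (fun j _ => ha j) (Finset.mem_univ i)
  have hlb : ∀ j, Real.log β ≤ Real.log (b j) := fun j => Real.log_le_log hβ (hb j)
  have hlb1 : ∀ j, Real.log (b j) ≤ 0 := fun j =>
    Real.log_nonpos (hβ.le.trans (hb j)) (hb1 j)
  have h4 : ∑ i, ∑ j, a i * overlap U V i j = 1 := by
    simp only [← Finset.mul_sum, sum_overlap hU hV, mul_one, ha1]
  -- The bound is independent of the state: `a log² a ≤ 4` and total overlap `card ι` give the first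
  -- summand, `log² b ≤ log² β` the second.
  have hC : ∑ i, ∑ j, a i * overlap U V i j * (Real.log (a i) - Real.log (b j)) ^ 2
      ≤ 8 * Fintype.card ι + 2 * Real.log β ^ 2 := by
    calc _ ≤ ∑ i, ∑ j, (overlap U V i j * (2 * 4) + a i * overlap U V i j * (2 * Real.log β ^ 2)) := by
            refine Finset.sum_le_sum fun i _ => Finset.sum_le_sum fun j _ => ?_
            have q1 := mul_sq_log_le (ha i) (ha1' i)
            have q2 : Real.log (b j) ^ 2 ≤ Real.log β ^ 2 := by nlinarith [hlb j, hlb1 j]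
            have q3 := overlap_nonneg U V i j
            have q4 := mul_nonneg (ha i) q3
            have q5 : (Real.log (a i) - Real.log (b j)) ^ 2
                ≤ 2 * Real.log (a i) ^ 2 + 2 * Real.log (b j) ^ 2 := by
              nlinarith [sq_nonneg (Real.log (a i) + Real.log (b j))]
            nlinarith [mul_le_mul_of_nonneg_left q5 q4, mul_le_mul_of_nonneg_left q1 q3,
              mul_le_mul_of_nonneg_left q2 q4]
      _ = _ := by
            simp only [Finset.sum_add_distrib, ← Finset.sum_mul, sum_overlap hU hV, h4]
            simp
            ring
  calc _ ≤ ∑ i, ∑ j, a i * overlap U V i j * (1 + s * (Real.log (a i) - Real.log (b j))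
            + (s * (Real.log (a i) - Real.log (b j))) ^ 2) := by
          refine Finset.sum_le_sum fun i _ => Finset.sum_le_sum fun j _ => ?_
          refine mul_le_mul_of_nonneg_left (exp_le_one_add_add_sq ?_)
            (mul_nonneg (ha i) (overlap_nonneg _ _ _ _))
          -- Since `log a ≤ 0` and `-log b ≤ -log β`, the exponent is at most `s * -log β ≤ 1`, the
          -- range of the quadratic bound. No lower bound on the exponent is needed.
          have := Real.log_nonpos (ha i) (ha1' i)
          nlinarith [hlb j]
    _ = 1 + s * (∑ i, ∑ j, a i * overlap U V i j * (Real.log (a i) - Real.log (b j)))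
          + s ^ 2 * ∑ i, ∑ j, a i * overlap U V i j * (Real.log (a i) - Real.log (b j)) ^ 2 := by
          conv_rhs => rw [← h4]
          simp only [Finset.mul_sum, ← Finset.sum_add_distrib]
          refine Finset.sum_congr rfl fun i _ => Finset.sum_congr rfl fun j _ => ?_
          ring
    _ ≤ 1 + s * (∑ i, ∑ j, a i * overlap U V i j * (Real.log (a i) - Real.log (b j)))
          + s ^ 2 * (8 * Fintype.card ι + 2 * Real.log β ^ 2) := by gcongr
    _ ≤ _ := by
          have := Real.add_one_le_exp (s * (∑ i, ∑ j, a i * overlap U V i j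
            * (Real.log (a i) - Real.log (b j))) + s ^ 2 * (8 * Fintype.card ι + 2 * Real.log β ^ 2))
          linarith

/-- `Tr ρ log σ`, with the logarithm taken on the support of `σ`. -/
noncomputable def traceLog (ρ σ : Matrix ι ι ℂ) : ℝ := (ρ * cfc Real.log σ).trace.re

theorem traceLog_conjDiag (U : Matrix ι ι ℂ) {V : Matrix ι ι ℂ} (hV : Vᴴ * V = 1)
    (hV' : V * Vᴴ = 1) (a b : ι → ℝ) :
    traceLog (conjDiag U a) (conjDiag V b)
      = ∑ i, ∑ j, a i * overlap U V i j * Real.log (b j) := by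
  rw [traceLog, cfc_conjDiag hV hV', trace_conjDiag_mul_conjDiag]
  exact Finset.sum_congr rfl fun i _ => Finset.sum_congr rfl fun j _ => by ring

theorem traceLog_conjDiag_self {U : Matrix ι ι ℂ} (hU : Uᴴ * U = 1) (hU' : U * Uᴴ = 1)
    (a : ι → ℝ) : traceLog (conjDiag U a) (conjDiag U a) = ∑ i, a i * Real.log (a i) := by
  rw [traceLog_conjDiag U hU hU']
  simp [overlap_self hU]

theorem traceLog_sub_conjDiag {U V : Matrix ι ι ℂ} (hU : Uᴴ * U = 1) (hU' : U * Uᴴ = 1)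
    (hV : Vᴴ * V = 1) (hV' : V * Vᴴ = 1) (a b : ι → ℝ) :
    traceLog (conjDiag U a) (conjDiag U a) - traceLog (conjDiag U a) (conjDiag V b)
      = ∑ i, ∑ j, a i * overlap U V i j * (Real.log (a i) - Real.log (b j)) := by
  rw [traceLog_conjDiag_self hU hU', traceLog_conjDiag U hV hV']
  rw [← Finset.sum_sub_distrib]
  refine Finset.sum_congr rfl fun i _ => ?_
  rw [← mul_one (a i * Real.log (a i)), ← sum_overlap hU hV' i, Finset.mul_sum,
    ← Finset.sum_sub_distrib]
  exact Finset.sum_congr rfl fun j _ => by ring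

end Letter

/-! ### Tests of product states against a power of a fixed state. -/

section State

variable {d : Type*} [Fintype d] [DecidableEq d]

theorem State.exists_conjDiag (ρ : State d) :
    ∃ (U : Matrix d d ℂ) (a : d → ℝ), Uᴴ * U = 1 ∧ U * Uᴴ = 1 ∧ (∀ i, 0 ≤ a i) ∧
      ∑ i, a i = 1 ∧ ρ.mat = conjDiag U a := by
  obtain ⟨U, a, hU, hU', ha, h⟩ := CQ.exists_conjDiag ρ.posSemidef
  refine ⟨U, a, hU, hU', ha, ?_, h⟩
  have := ρ.trace_eq_one
  rw [h, trace_conjDiag hU] at this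
  exact_mod_cast this

theorem le_of_sub_smul_posSemidef {V : Matrix d d ℂ} {b : d → ℝ} (hV : Vᴴ * V = 1)
    (hV' : V * Vᴴ = 1) {β : ℝ} (h : (conjDiag V b - (β : ℂ) • 1).PosSemidef) (i : d) :
    β ≤ b i := by
  rw [← conjDiag_one hV', conjDiag_smul, conjDiag_sub] at h
  linarith [nonneg_of_conjDiag_posSemidef hV h i]

/-- The success probability of a test for a product state against a product state `σ^{⊗ n}`. -/
theorem trace_tensor_mul_le {n : ℕ} (ρ : Fin n → State d) (σ : State d) {β r s : ℝ} (hβ : 0 < β)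
    (hσ : (σ.mat - (β : ℂ) • 1).PosSemidef)
    (hr : ∀ k, traceLog (ρ k).mat (ρ k).mat - traceLog (ρ k).mat σ.mat ≤ r)
    (hs : 0 ≤ s) (hsβ : s * -Real.log β ≤ 1) {ε c : ℝ} (hε : 0 < ε) (hc : 0 < c)
    {T : Matrix (Fin n → d) (Fin n → d) ℂ} (hT : T.PosSemidef) (hT' : (1 - T).PosSemidef) :
    ((State.tensor ρ).mat * T).trace.re
      ≤ ε + Real.exp (-s * Real.log (ε * c)
          + n * (s * r + s ^ 2 * (8 * Fintype.card d + 2 * Real.log β ^ 2)))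
        + c * ((State.tensor fun _ : Fin n => σ).mat * T).trace.re := by
  choose U a hU hU' ha ha1 h using fun k => (ρ k).exists_conjDiag
  obtain ⟨V, b, hV, hV', hb, hb1, hσV⟩ := σ.exists_conjDiag
  have hbβ : ∀ j, β ≤ b j := fun j => by
    rw [hσV] at hσ
    exact le_of_sub_smul_posSemidef hV hV' hσ j
  have hb1' : ∀ i, b i ≤ 1 := fun i =>
    hb1 ▸ Finset.single_le_sum (fun j _ => hb j) (Finset.mem_univ i)
  have e1 : (State.tensor ρ).mat = conjDiag (tensorMat U) fun w => ∏ k, a k (w k) := by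
    simp only [State.tensor, h, tensorMat_conjDiag]
  have e2 : (State.tensor fun _ : Fin n => σ).mat
      = conjDiag (tensorMat fun _ => V) fun w => ∏ k, b (w k) := by
    simp only [State.tensor, hσV, tensorMat_conjDiag (fun _ => V) (fun _ => b)]
  have hsum : ∑ w : Fin n → d, ∏ k, a k (w k) = 1 := by
    rw [← Fintype.prod_sum]; simp [ha1]
  rw [e1, e2]
  refine (trace_mul_le_of_overlap (b := fun w => ∏ k, b (w k)) (tensorMat_conjTranspose_mul_self hU)
    (tensorMat_mul_conjTranspose_self fun _ => hV') (tensorMat_mul_conjTranspose_self hU')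
    (fun w => Finset.prod_nonneg fun k _ => ha k _) hsum
    (fun w => Finset.prod_nonneg fun k _ => hb _) hT hT' hε hc.le).trans ?_
  refine add_le_add_left (add_le_add_right ?_ _) _
  -- Exponential Markov inequality: on the event counted, the log-likelihood ratio exceeds `log (ε
  -- c)`, so the exponential factor is at least `1`. A nonzero weight also makes every factor `a k
  -- (i k)` nonzero, so logarithms of products split.
  have hterm : ∀ i j : Fin n → d,
      (if ∏ k, a k (i k) ≤ ε * c * ∏ k, b (j k) then 0
        else (∏ k, a k (i k)) * overlap (tensorMat U) (tensorMat fun _ => V) i j)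
      ≤ Real.exp (-s * Real.log (ε * c)) * ∏ k, (a k (i k) * overlap (U k) V (i k) (j k)
          * Real.exp (s * (Real.log (a k (i k)) - Real.log (b (j k))))) := by
    intro i j
    have hbpos : 0 < ∏ k, b (j k) := Finset.prod_pos fun k _ => hβ.trans_le (hbβ _)
    have hnn : 0 ≤ ∏ k, (a k (i k) * overlap (U k) V (i k) (j k)) :=
      Finset.prod_nonneg fun k _ => mul_nonneg (ha k _) (overlap_nonneg _ _ _ _)
    rw [Finset.prod_mul_distrib, ← Real.exp_sum, ← Finset.mul_sum, Finset.sum_sub_distrib]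
    split_ifs with hle
    · positivity
    · push Not at hle
      have hapos : 0 < ∏ k, a k (i k) := lt_of_le_of_lt (by positivity) hle
      have hane : ∀ k ∈ Finset.univ, a k (i k) ≠ 0 := Finset.prod_ne_zero_iff.1 hapos.ne'
      rw [← Real.log_prod hane, ← Real.log_prod fun k _ => (hβ.trans_le (hbβ _)).ne',
        mul_left_comm, ← Real.exp_add, overlap_tensorMat, ← Finset.prod_mul_distrib]
      refine le_mul_of_one_le_right hnn (Real.one_le_exp ?_)
      have := Real.log_lt_log (by positivity) hle
      rw [Real.log_mul (by positivity) hbpos.ne'] at this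
      nlinarith
  calc _ ≤ ∑ i : Fin n → d, ∑ j : Fin n → d, Real.exp (-s * Real.log (ε * c))
          * ∏ k, (a k (i k) * overlap (U k) V (i k) (j k)
          * Real.exp (s * (Real.log (a k (i k)) - Real.log (b (j k))))) :=
        Finset.sum_le_sum fun i _ => Finset.sum_le_sum fun j _ => hterm i j
    _ = Real.exp (-s * Real.log (ε * c)) * ∏ k, ∑ i, ∑ j, (a k i * overlap (U k) V i j
          * Real.exp (s * (Real.log (a k i) - Real.log (b j)))) := by
        simp only [← Finset.mul_sum]
        rw [sum_sum_prod_eq_prod_sum_sum fun k i j => a k i * overlap (U k) V i j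
          * Real.exp (s * (Real.log (a k i) - Real.log (b j)))]
    _ ≤ Real.exp (-s * Real.log (ε * c)) * ∏ _k : Fin n, Real.exp (s * r
          + s ^ 2 * (8 * Fintype.card d + 2 * Real.log β ^ 2)) := by
        refine mul_le_mul_of_nonneg_left (Finset.prod_le_prod (fun k _ => ?_) fun k _ => ?_)
          (Real.exp_nonneg _)
        · exact Finset.sum_nonneg fun i _ => Finset.sum_nonneg fun j _ =>
            mul_nonneg (mul_nonneg (ha k _) (overlap_nonneg _ _ _ _)) (Real.exp_nonneg _)
        · refine (sum_overlap_exp_le (hU k) hV' (ha k) (ha1 k) hβ hbβ hb1' hs hsβ).trans ?_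
          have := hr k
          rw [h k, hσV, traceLog_sub_conjDiag (hU k) (hU' k) hV hV'] at this
          gcongr
    _ = _ := by
        rw [Finset.prod_const, Finset.card_univ, Fintype.card_fin, ← Real.exp_nat_mul,
          ← Real.exp_add]

end State

/-! ### Supports and Klein's inequality -/

section Support

variable {ι : Type*} [Fintype ι] [DecidableEq ι]

theorem conjDiag_smul_real (U : Matrix ι ι ℂ) (c : ℝ) (a : ι → ℝ) :
    c • conjDiag U a = conjDiag U (fun i => c * a i) := by
  rw [← Complex.coe_smul, conjDiag_smul]

/-- `conjDiag V e` is the projection onto the kernel of `conjDiag V b`. Range inclusion says that it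
annihilates `conjDiag U a`, and the trace of that product is a sum of nonnegative terms. Conversely,
the pseudo-inverse of `conjDiag V b` exhibits the factorization. -/
theorem range_conjDiag_le_iff {U V : Matrix ι ι ℂ} (hV : Vᴴ * V = 1)
    (hV' : V * Vᴴ = 1) {a : ι → ℝ} (b : ι → ℝ) (ha : ∀ i, 0 ≤ a i) :
    LinearMap.range (conjDiag U a).mulVecLin ≤ LinearMap.range (conjDiag V b).mulVecLin ↔
      ∀ i j, b j = 0 → a i * overlap U V i j = 0 := by
  set e : ι → ℝ := fun j => if b j = 0 then 1 else 0 with he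
  constructor
  · intro h
    have hEA : conjDiag V e * conjDiag U a = 0 := by
      refine mulVec_injective (funext fun w => ?_)
      rw [← mulVec_mulVec]
      obtain ⟨u, hu⟩ := h ⟨w, rfl⟩
      rw [mulVecLin_apply, mulVecLin_apply] at hu
      rw [← hu, mulVec_mulVec, conjDiag_mul hV]
      have : (fun j => e j * b j) = fun _ => 0 := by
        funext j
        simp only [he]
        split_ifs with h <;> simp [h]
      rw [this]
      simp [conjDiag]
    intro i j hj
    have h0 : (conjDiag U a * conjDiag V e).trace.re = 0 := by
      rw [trace_mul_comm, hEA]; simp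
    rw [trace_conjDiag_mul_conjDiag] at h0
    have hnn : ∀ i j, 0 ≤ a i * (e j * overlap U V i j) := fun i j =>
      mul_nonneg (ha i) (mul_nonneg (by simp only [he]; split_ifs <;> norm_num)
        (overlap_nonneg _ _ _ _))
    rw [Finset.sum_eq_zero_iff_of_nonneg fun i _ => Finset.sum_nonneg fun j _ => hnn i j] at h0
    have h1 := h0 i (Finset.mem_univ i)
    rw [Finset.sum_eq_zero_iff_of_nonneg fun j _ => hnn i j] at h1
    simpa [he, hj] using h1 j (Finset.mem_univ j)
  · intro h
    have hEA : diagonal (fun j => (e j : ℂ)) * (Vᴴ * U) * diagonal (fun i => (a i : ℂ)) = 0 := by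
      ext j i
      rw [mul_diagonal, diagonal_mul, Matrix.zero_apply]
      simp only [he]
      split_ifs with hj
      · rcases mul_eq_zero.1 (h i j hj) with h0 | h0
        · simp [h0]
        · rw [overlap_comm, overlap, Complex.normSq_eq_zero] at h0
          simp [h0]
      · simp
    have hA : conjDiag U a = conjDiag V b * (conjDiag V (fun j => (b j)⁻¹) * conjDiag U a) := by
      have h1 : conjDiag V e * conjDiag U a = 0 := by
        have : conjDiag V e * conjDiag U a = V * (diagonal (fun j => (e j : ℂ)) * (Vᴴ * U) *
            diagonal (fun i => (a i : ℂ))) * Uᴴ := by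
          simp only [conjDiag, Matrix.mul_assoc]
        rw [this, hEA]; simp
      have h2 : (fun j => b j * (b j)⁻¹) = fun j => 1 - e j := by
        funext j
        simp only [he]
        split_ifs with hj <;> simp [hj]
      rw [← Matrix.mul_assoc, conjDiag_mul hV, h2, ← conjDiag_sub, conjDiag_one hV',
        Matrix.sub_mul, h1, Matrix.one_mul, sub_zero]
    rw [hA, mulVecLin_mul]
    exact LinearMap.range_comp_le_range _ _

/-- On a kernel vector of `B` the quadratic form of `B - c A` is `-c` times that of `A`, so both
vanish. -/
theorem range_le_of_posSemidef_sub {A B : Matrix ι ι ℂ} (hA : A.PosSemidef) (hB : B.PosSemidef)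
    {c : ℝ} (hc : 0 < c) (h : (B - c • A).PosSemidef) :
    LinearMap.range A.mulVecLin ≤ LinearMap.range B.mulVecLin := by
  obtain ⟨U, a, hU, hU', ha, rfl⟩ := exists_conjDiag hA
  obtain ⟨V, b, hV, hV', hb, rfl⟩ := exists_conjDiag hB
  rw [range_conjDiag_le_iff hV hV' b ha]
  intro i j hj
  have h1 := re_trace_mul_nonneg h
    (conjDiag_posSemidef V (a := Pi.single j 1) (fun k => by
      by_cases hk : k = j
      · subst hk; simp
      · simp [hk]))
  rw [conjDiag_smul_real, Matrix.sub_mul, trace_sub, Complex.sub_re, trace_conjDiag_mul_conjDiag,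
    trace_conjDiag_mul_conjDiag] at h1
  simp only [Pi.single_apply, overlap_self hV, ite_mul, one_mul, zero_mul, mul_ite, mul_zero,
    Finset.sum_ite_eq', Finset.mem_univ, if_true] at h1
  simp [hj] at h1
  have hnn : ∀ i, 0 ≤ c * a i * overlap U V i j := fun i =>
    mul_nonneg (mul_nonneg hc.le (ha i)) (overlap_nonneg _ _ _ _)
  have h2 := (Finset.sum_eq_zero_iff_of_nonneg fun i _ => hnn i).1
    (le_antisymm h1 (Finset.sum_nonneg fun i _ => hnn i)) i (Finset.mem_univ i)
  rw [mul_assoc] at h2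
  exact (mul_eq_zero.1 h2).resolve_left hc.ne'

/-- `ρ ↦ Tr ρ log σ` as a linear map. -/
noncomputable def traceLogLin (σ : Matrix ι ι ℂ) : Matrix ι ι ℂ →ₗ[ℝ] ℝ where
  toFun ρ := traceLog ρ σ
  map_add' ρ ρ' := by simp [traceLog, Matrix.add_mul]
  map_smul' c ρ := by simp [traceLog]

variable {d : Type*} [Fintype d] [DecidableEq d]

/-- Klein's inequality, from `log x ≤ x - 1` applied to each ratio `b j / a i`; the linear terms
cancel because both traces are `1`. Where `b j = 0 < a i`, the support condition makes the overlap
vanish. -/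
theorem traceLog_le_traceLog_self {ρ σ : State d}
    (h : LinearMap.range ρ.mat.mulVecLin ≤ LinearMap.range σ.mat.mulVecLin) :
    traceLog ρ.mat σ.mat ≤ traceLog ρ.mat ρ.mat := by
  obtain ⟨U, a, hU, hU', ha, ha1, hρ⟩ := ρ.exists_conjDiag
  obtain ⟨V, b, hV, hV', hb, hb1, hσ⟩ := σ.exists_conjDiag
  rw [hρ, hσ] at h ⊢
  rw [range_conjDiag_le_iff hV hV' b ha] at h
  rw [← sub_nonneg, traceLog_sub_conjDiag hU hU' hV hV']
  have h1 : ∑ i, ∑ j, overlap U V i j * (a i - b j) = 0 := by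
    simp only [mul_sub, Finset.sum_sub_distrib]
    rw [Finset.sum_comm (f := fun i j => overlap U V i j * b j)]
    simp only [← Finset.sum_mul, overlap_comm U V, sum_overlap hV hU']
    simp [ha1, hb1, overlap_comm V U, sum_overlap hU hV']
  rw [← h1]
  refine Finset.sum_le_sum fun i _ => Finset.sum_le_sum fun j _ => ?_
  have ho := overlap_nonneg U V i j
  rcases (ha i).eq_or_lt with h0 | h0
  · rw [← h0]; nlinarith [mul_nonneg ho (hb j)]
  rcases (hb j).eq_or_lt with h2 | h2
  · have := (mul_eq_zero.1 (h i j h2.symm)).resolve_left h0.ne'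
    simp [this]
  have h3 := Real.log_le_sub_one_of_pos (div_pos h2 h0)
  rw [Real.log_div h2.ne' h0.ne', le_sub_iff_add_le, le_div_iff₀ h0] at h3
  nlinarith

/-- Operator monotonicity of the logarithm. The shift `ε` makes the smaller matrix positive definite
and only increases `Tr ρ log σ`: kernel directions of `σ` carry no weight of `ρ`. -/
theorem traceLog_add_log_le {ρ σ : State d}
    (h : LinearMap.range ρ.mat.mulVecLin ≤ LinearMap.range σ.mat.mulVecLin)
    {τ : Matrix d d ℂ} {c ε : ℝ} (hc : 0 < c) (hε : 0 < ε)
    (hτ : (τ - c • (σ.mat + ε • (1 : Matrix d d ℂ))).PosSemidef) :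
    traceLog ρ.mat σ.mat + Real.log c ≤ traceLog ρ.mat τ := by
  obtain ⟨U, a, hU, hU', ha, ha1, hρ⟩ := ρ.exists_conjDiag
  obtain ⟨V, b, hV, hV', hb, hb1, hσ⟩ := σ.exists_conjDiag
  have hB : c • (σ.mat + ε • (1 : Matrix d d ℂ)) = conjDiag V (fun j => c * (b j + ε)) := by
    rw [hσ, ← conjDiag_one hV', conjDiag_smul_real, conjDiag_add, conjDiag_smul_real]
    simp
  have hpos : (conjDiag V (fun j => c * (b j + ε))).PosDef := by
    rw [← hB]
    have h1 : (ε • (1 : Matrix d d ℂ)).PosDef := PosDef.one.smul hε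
    exact (h1.posSemidef_add σ.posSemidef).smul hc
  rw [hB] at hτ
  have h1 := re_trace_mul_nonneg ρ.posSemidef (cfc_log_le_cfc_log hpos hτ)
  rw [Matrix.mul_sub, trace_sub, Complex.sub_re, sub_nonneg] at h1
  refine le_trans ?_ h1
  change _ ≤ traceLog _ _
  rw [hρ, hσ] at h ⊢
  rw [range_conjDiag_le_iff hV hV' b ha] at h
  rw [traceLog_conjDiag U hV hV', traceLog_conjDiag U hV hV']
  have h4 : Real.log c = ∑ i, ∑ j, a i * overlap U V i j * Real.log c := by
    simp only [← Finset.sum_mul, ← Finset.mul_sum, sum_overlap hU hV', mul_one, ha1, one_mul]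
  rw [h4]
  simp only [← Finset.sum_add_distrib]
  refine Finset.sum_le_sum fun i _ => Finset.sum_le_sum fun j _ => ?_
  have ho := mul_nonneg (ha i) (overlap_nonneg U V i j)
  rcases (hb j).eq_or_lt with h2 | h2
  · simp [h i j h2.symm]
  · rw [Real.log_mul hc.ne' (by positivity)]
    have := Real.log_le_log h2 (show b j ≤ b j + ε by linarith)
    nlinarith

end Support

/-! ### The Holevo quantity -/

section Holevo

variable {X d : Type*} [Fintype d] [DecidableEq d] (W : Channel X d)

/-- The average output state, as a matrix. -/
noncomputable def Channel.avgMat (p : FinDist X) : Matrix d d ℂ :=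
  Finsupp.linearCombination ℝ (fun x => (W x).mat) p.prob

theorem FinDist.linearCombination_eq_sum {M : Type*} [AddCommGroup M] [Module ℝ M]
    (p : FinDist X) (f : X → M) :
    Finsupp.linearCombination ℝ f p.prob = ∑ x : p.prob.support, p.prob x • f x := by
  rw [Finsupp.linearCombination_apply, Finsupp.sum, ← Finset.sum_coe_sort]

theorem FinDist.sum_coe_eq_one (p : FinDist X) : ∑ x : p.prob.support, p.prob x = 1 := by
  rw [Finset.sum_coe_sort p.prob.support p.prob, p.sum_eq_one]

theorem FinDist.pos (p : FinDist X) (x : p.prob.support) : 0 < p.prob x :=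
  lt_of_le_of_ne (p.nonneg x) (Finsupp.mem_support_iff.1 x.2).symm

/-- The average output state. -/
noncomputable def Channel.avgState (p : FinDist X) : State d where
  mat := W.avgMat p
  posSemidef := by
    rw [Channel.avgMat, p.linearCombination_eq_sum]
    exact posSemidef_sum _ fun x _ => (W x).posSemidef.smul (p.nonneg x)
  trace_eq_one := by
    rw [Channel.avgMat, p.linearCombination_eq_sum, trace_sum]
    simp only [trace_smul, State.trace_eq_one]
    rw [← Finset.sum_smul, p.sum_coe_eq_one, one_smul]

/-- The Holevo information of an input distribution, in nats. -/
noncomputable def Channel.holevoInfo (p : FinDist X) : ℝ :=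
  Finsupp.linearCombination ℝ (fun x => traceLog (W x).mat (W x).mat) p.prob
    - traceLog (W.avgMat p) (W.avgMat p)

theorem Channel.traceLog_avgMat (p : FinDist X) (σ : Matrix d d ℂ) :
    traceLog (W.avgMat p) σ
      = Finsupp.linearCombination ℝ (fun x => traceLog (W x).mat σ) p.prob :=
  (traceLogLin σ).map_finsupp_linearCombination _

theorem Channel.range_le_range_avgMat (p : FinDist X) (x : p.prob.support) :
    LinearMap.range (W x).mat.mulVecLin ≤ LinearMap.range (W.avgMat p).mulVecLin := by
  classical
  refine range_le_of_posSemidef_sub (W x).posSemidef (W.avgState p).posSemidef (p.pos x) ?_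
  rw [Channel.avgMat, p.linearCombination_eq_sum, ← Finset.add_sum_erase _ _ (Finset.mem_univ x),
    add_sub_cancel_left]
  exact posSemidef_sum _ fun x _ => (W x).posSemidef.smul (p.nonneg x)

theorem Channel.range_avgMat_le (p : FinDist X) {σ : Matrix d d ℂ}
    (h : ∀ x : p.prob.support,
      LinearMap.range (W x).mat.mulVecLin ≤ LinearMap.range σ.mulVecLin) :
    LinearMap.range (W.avgMat p).mulVecLin ≤ LinearMap.range σ.mulVecLin := by
  rintro _ ⟨v, rfl⟩
  rw [Channel.avgMat, p.linearCombination_eq_sum, mulVecLin_apply, sum_mulVec]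
  refine Submodule.sum_mem _ fun x _ => ?_
  rw [← Complex.coe_smul, smul_mulVec]
  exact Submodule.smul_mem _ _ (h x ⟨v, rfl⟩)

end Holevo

/-! ### Spectral decompositions of block diagonal matrices. -/

section Block

variable {κ d : Type*} [Fintype κ] [DecidableEq κ] [Fintype d] [DecidableEq d]

/-- The block diagonal matrix `∑ |x⟩⟨x| ⊗ M x`. -/
def blockMat {κ d : Type*} [DecidableEq κ] (M : κ → Matrix d d ℂ) : Matrix (κ × d) (κ × d) ℂ :=
  -- `blockDiagonal` has the block label as its second index; the swap puts it first, as in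
  -- `cqState`.
  (blockDiagonal M).submatrix (Equiv.prodComm κ d) (Equiv.prodComm κ d)

theorem blockMat_apply {κ d : Type*} [DecidableEq κ] (M : κ → Matrix d d ℂ) (q r : κ × d) :
    blockMat M q r = if q.1 = r.1 then M q.1 q.2 r.2 else 0 := rfl

theorem blockMat_mul (M N : κ → Matrix d d ℂ) :
    blockMat M * blockMat N = blockMat fun x => M x * N x := by
  rw [blockMat, blockMat, submatrix_mul_equiv, ← blockDiagonal_mul]; rfl

theorem blockMat_conjTranspose (M : κ → Matrix d d ℂ) :
    (blockMat M)ᴴ = blockMat fun x => (M x)ᴴ := by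
  rw [blockMat, conjTranspose_submatrix, blockDiagonal_conjTranspose]; rfl

theorem blockMat_one : blockMat (fun _ : κ => (1 : Matrix d d ℂ)) = 1 := by
  rw [blockMat]
  erw [blockDiagonal_one]
  exact submatrix_one_equiv _

theorem blockMat_conjDiag (U : κ → Matrix d d ℂ) (a : κ → d → ℝ) :
    blockMat (fun x => conjDiag (U x) (a x)) = conjDiag (blockMat U) fun q => a q.1 q.2 := by
  have : diagonal (fun q : κ × d => (a q.1 q.2 : ℂ))
      = blockMat fun x => diagonal fun i => (a x i : ℂ) := by
    ext q r
    simp only [blockMat_apply, diagonal_apply, Prod.ext_iff]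
    split_ifs <;> simp_all
  rw [conjDiag, this, blockMat_conjTranspose, blockMat_mul, blockMat_mul]
  rfl

theorem overlap_blockMat (U V : κ → Matrix d d ℂ) (q r : κ × d) :
    overlap (blockMat U) (blockMat V) q r
      = if q.1 = r.1 then overlap (U q.1) (V q.1) q.2 r.2 else 0 := by
  rw [overlap, blockMat_conjTranspose, blockMat_mul, blockMat_apply]
  split_ifs <;> simp [overlap]

end Block

/-! ### Relative entropy of the classical-quantum state. -/

section RelEntropy

variable {ι : Type*} [Fintype ι] [DecidableEq ι]

theorem relEntropy_conjDiag_of_support {U V : Matrix ι ι ℂ} (hU : Uᴴ * U = 1) (hU' : U * Uᴴ = 1)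
    (hV : Vᴴ * V = 1) (hV' : V * Vᴴ = 1) {a : ι → ℝ} (b : ι → ℝ) (ha : ∀ i, 0 ≤ a i)
    (h : ∀ i j, b j = 0 → a i * overlap U V i j = 0) :
    relEntropy (conjDiag U a) (conjDiag V b)
      = (((∑ i, ∑ j, a i * overlap U V i j * (Real.log (a i) - Real.log (b j))) / Real.log 2 :
          ℝ) : EReal) := by
  rw [relEntropy, if_pos ((range_conjDiag_le_iff hV hV' b ha).2 h)]
  congr 1
  rw [cfc_conjDiag hU hU', cfc_conjDiag hV hV', Matrix.mul_sub, conjDiag_mul hU, trace_sub,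
    trace_conjDiag hU, Complex.sub_re, trace_conjDiag_mul_conjDiag, Finset.sum_div,
    Complex.re_sum, ← Finset.sum_sub_distrib]
  refine Finset.sum_congr rfl fun i _ => ?_
  rw [Complex.ofReal_re, ← mul_one (a i * _), ← sum_overlap hU hV' i, Finset.mul_sum,
    ← Finset.sum_sub_distrib, Finset.sum_div]
  refine Finset.sum_congr rfl fun j _ => ?_
  simp only [Real.logb]
  ring

theorem relEntropy_conjDiag_of_not_support {U V : Matrix ι ι ℂ}
    (hV : Vᴴ * V = 1) (hV' : V * Vᴴ = 1) {a : ι → ℝ} (b : ι → ℝ) (ha : ∀ i, 0 ≤ a i)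
    (h : ¬ ∀ i j, b j = 0 → a i * overlap U V i j = 0) :
    relEntropy (conjDiag U a) (conjDiag V b) = ⊤ := by
  rw [relEntropy, if_neg fun h' => h ((range_conjDiag_le_iff hV hV' b ha).1 h')]

variable {X d : Type*} [Fintype d] [DecidableEq d] (W : Channel X d)

open Classical in
theorem Channel.cqState_eq (p : FinDist X) :
    W.cqState p = blockMat fun x : p.prob.support => p.prob x • (W x).mat := by
  ext q r
  rw [Channel.cqState, Matrix.sum_apply, blockMat_apply]
  split_ifs with h
  · rw [Finset.sum_eq_single q.1]
    · simp [kroneckerMap_apply, h]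
    · intro y _ hy
      simp [kroneckerMap_apply, hy]
    · simp
  · refine Finset.sum_eq_zero fun y _ => ?_
    have : ¬ (y = q.1 ∧ y = r.1) := fun ⟨h1, h2⟩ => h (h1 ▸ h2)
    simp [kroneckerMap_apply, this]

open Classical in
theorem FinDist.inputState_kronecker (p : FinDist X) (σ : Matrix d d ℂ) :
    p.inputState ⊗ₖ σ = blockMat fun x : p.prob.support => p.prob x • σ := by
  ext q r
  rw [FinDist.inputState, kroneckerMap_apply, Matrix.sum_apply, blockMat_apply]
  split_ifs with h
  · rw [Finset.sum_eq_single q.1]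
    · simp [h]
    · intro y _ hy
      simp [hy]
    · simp
  · rw [Finset.sum_eq_zero, zero_mul]
    intro y _
    have : ¬ (y = q.1 ∧ y = r.1) := fun ⟨h1, h2⟩ => h (h1 ▸ h2)
    simp [this]

-- Both arguments are block diagonal with the same positive weights `p x`. These do not affect
-- supports and cancel in the difference of logarithms.
open Classical in
theorem Channel.relEntropy_cqState (p : FinDist X) (σ : State d) :
    relEntropy (W.cqState p) (p.inputState ⊗ₖ σ.mat)
      = if ∀ x : p.prob.support,
          LinearMap.range (W x).mat.mulVecLin ≤ LinearMap.range σ.mat.mulVecLin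
        then (((Finsupp.linearCombination ℝ (fun x => traceLog (W x).mat (W x).mat) p.prob
          - traceLog (W.avgMat p) σ.mat) / Real.log 2 : ℝ) : EReal) else ⊤ := by
  choose U a hU hU' ha ha1 hW using fun x => (W x).exists_conjDiag
  obtain ⟨V, b, hV, hV', hb, hb1, hσ⟩ := σ.exists_conjDiag
  have e1 : W.cqState p = conjDiag (blockMat fun x : p.prob.support => U x)
      fun q => p.prob q.1 * a q.1 q.2 := by
    rw [W.cqState_eq, ← blockMat_conjDiag (fun x : p.prob.support => U x)
      (fun x i => p.prob x * a x i)]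
    simp only [hW, conjDiag_smul_real]
  have e2 : p.inputState ⊗ₖ σ.mat = conjDiag (blockMat fun _ : p.prob.support => V)
      fun q => p.prob q.1 * b q.2 := by
    rw [p.inputState_kronecker, ← blockMat_conjDiag (fun _ : p.prob.support => V)
      (fun x i => p.prob x * b i)]
    simp only [hσ, conjDiag_smul_real]
  have u1 : (blockMat fun x : p.prob.support => U x)ᴴ * (blockMat fun x : p.prob.support => U x)
      = 1 := by
    rw [blockMat_conjTranspose, blockMat_mul]; simp only [hU, blockMat_one]
  have u2 : (blockMat fun x : p.prob.support => U x) * (blockMat fun x : p.prob.support => U x)ᴴ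
      = 1 := by
    rw [blockMat_conjTranspose, blockMat_mul]; simp only [hU', blockMat_one]
  have v1 : (blockMat fun _ : p.prob.support => V)ᴴ * (blockMat fun _ : p.prob.support => V)
      = 1 := by
    rw [blockMat_conjTranspose, blockMat_mul]; simp only [hV, blockMat_one]
  have v2 : (blockMat fun _ : p.prob.support => V) * (blockMat fun _ : p.prob.support => V)ᴴ
      = 1 := by
    rw [blockMat_conjTranspose, blockMat_mul]; simp only [hV', blockMat_one]
  have hnn : ∀ q : p.prob.support × d, 0 ≤ p.prob q.1 * a q.1 q.2 := fun q =>
    mul_nonneg (p.nonneg _) (ha _ _)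
  have hsupp : (∀ x : p.prob.support,
      LinearMap.range (W x).mat.mulVecLin ≤ LinearMap.range σ.mat.mulVecLin) ↔
      ∀ q r : p.prob.support × d, p.prob r.1 * b r.2 = 0 → p.prob q.1 * a q.1 q.2 *
        overlap (blockMat fun x : p.prob.support => U x) (blockMat fun _ : p.prob.support => V)
          q r = 0 := by
    have : ∀ x : p.prob.support, (LinearMap.range (W x).mat.mulVecLin
        ≤ LinearMap.range σ.mat.mulVecLin ↔
          ∀ i j, b j = 0 → a x i * overlap (U x) V i j = 0) := fun x => by
      rw [hW, hσ, range_conjDiag_le_iff hV hV' b (ha x)]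
    simp only [this, overlap_blockMat]
    constructor
    · rintro h ⟨x, i⟩ ⟨y, j⟩ hz
      have hz' := (mul_eq_zero.1 hz).resolve_left (p.pos y).ne'
      split_ifs
      · rw [mul_assoc, h x i j hz', mul_zero]
      · simp
    · intro h x i j hj
      have h1 := h (x, i) (x, j) (by simp [hj])
      rw [if_pos rfl, mul_assoc] at h1
      exact (mul_eq_zero.1 h1).resolve_left (p.pos x).ne'
  split_ifs with h
  · rw [e1, e2, relEntropy_conjDiag_of_support u1 u2 v1 v2 _ hnn (hsupp.1 h)]
    congr 2
    rw [W.traceLog_avgMat, p.linearCombination_eq_sum, p.linearCombination_eq_sum,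
      ← Finset.sum_sub_distrib, Fintype.sum_prod_type]
    refine Finset.sum_congr rfl fun x _ => ?_
    rw [← smul_sub, hW, hσ, traceLog_sub_conjDiag (hU x) (hU' x) hV hV', smul_eq_mul,
      Finset.mul_sum]
    refine Finset.sum_congr rfl fun i _ => ?_
    rw [Fintype.sum_prod_type, Finset.sum_eq_single x, Finset.mul_sum]
    · refine Finset.sum_congr rfl fun j _ => ?_
      rw [overlap_blockMat, if_pos rfl]
      rcases (ha x i).eq_or_lt with h0 | h0
      · simp [← h0]
      rcases (hb j).eq_or_lt with h2 | h2
      · have := (hsupp.1 h) (x, i) (x, j) (by simp [← h2])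
        rw [overlap_blockMat, if_pos rfl, mul_assoc] at this
        have := (mul_eq_zero.1 this).resolve_left (p.pos x).ne'
        have := (mul_eq_zero.1 this).resolve_left h0.ne'
        simp only at this
        simp [this]
      · rw [Real.log_mul (p.pos x).ne' h0.ne', Real.log_mul (p.pos x).ne' h2.ne']
        ring
    · intro y _ hy
      refine Finset.sum_eq_zero fun j _ => ?_
      rw [overlap_blockMat, if_neg (Ne.symm hy)]
      simp
    · simp
  · rw [e1, e2, relEntropy_conjDiag_of_not_support v1 v2 _ hnn fun h' => h (hsupp.2 h')]

/-- The average state attains the infimum: only `Tr ρ_B log σ` depends on `σ`, and Klein's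
inequality maximizes it at `σ = ρ_B`. -/
theorem Channel.holevoQuantity_eq (p : FinDist X) :
    W.holevoQuantity p = ((W.holevoInfo p / Real.log 2 : ℝ) : EReal) := by
  classical
  refine le_antisymm ?_ (le_iInf fun σ => ?_)
  · refine (iInf_le _ (W.avgState p)).trans (le_of_eq ?_)
    have := (W.relEntropy_cqState p (W.avgState p)).trans (if_pos (W.range_le_range_avgMat p))
    convert this
    rfl
  · have := W.relEntropy_cqState p σ
    refine le_trans ?_ (le_of_eq (Eq.trans this.symm (by congr!)))
    split_ifs with h
    · rw [EReal.coe_le_coe_iff]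
      refine div_le_div_of_nonneg_right (sub_le_sub_left ?_ _) (Real.log_nonneg one_le_two)
      exact traceLog_le_traceLog_self (ρ := W.avgState p) (W.range_avgMat_le p h)
    · exact le_top

end RelEntropy

/-! ### A state whose divergence from all outputs is at most the capacity -/

section Center

variable {X d : Type*} [Fintype d] [DecidableEq d] (W : Channel X d)

open Classical in
/-- The mixture `(1 - t) p + t δ_x`. -/
noncomputable def FinDist.mix (p : FinDist X) (x : X) (t : ℝ) (h0 : 0 ≤ t) (h1 : t ≤ 1) :
    FinDist X where
  prob := (1 - t) • p.prob + t • Finsupp.single x 1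
  nonneg y := by
    have := p.nonneg y
    have h2 : 0 ≤ 1 - t := sub_nonneg.2 h1
    simp only [Finsupp.add_apply, Finsupp.smul_apply, smul_eq_mul, Finsupp.single_apply]
    split_ifs <;> positivity
  sum_eq_one := by
    have h (q : X →₀ ℝ) :
        ∑ y ∈ q.support, q y = Finsupp.linearCombination ℝ (fun _ => (1 : ℝ)) q := by
      simp [Finsupp.linearCombination_apply, Finsupp.sum]
    have hp := p.sum_eq_one
    rw [h] at hp ⊢
    rw [map_add, map_smul, map_smul, hp]
    simp

theorem FinDist.linearCombination_mix {M : Type*} [AddCommGroup M] [Module ℝ M] (p : FinDist X)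
    (x : X) (t : ℝ) (h0 : 0 ≤ t) (h1 : t ≤ 1) (f : X → M) :
    Finsupp.linearCombination ℝ f (p.mix x t h0 h1).prob
      = (1 - t) • Finsupp.linearCombination ℝ f p.prob + t • f x := by
  simp [FinDist.mix]

theorem Channel.avgMat_mix (p : FinDist X) (x : X) (t : ℝ) (h0 : 0 ≤ t) (h1 : t ≤ 1) :
    W.avgMat (p.mix x t h0 h1) = (1 - t) • W.avgMat p + t • (W x).mat :=
  p.linearCombination_mix x t h0 h1 _

/-- Expanding the entropy of the mixed average state linearly gives an identity with the extra term
`(1 - t) D(ρ_p ‖ ρ_q) ≥ 0`, which is dropped. As `t` tends to `0` this bounds the one-sided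
derivative of the Holevo information towards `x`. -/
theorem Channel.le_holevoInfo_mix (p : FinDist X) (x : X) {t : ℝ} (h0 : 0 ≤ t) (h1 : t < 1) :
    (1 - t) * W.holevoInfo p + t * (traceLog (W x).mat (W x).mat
      - traceLog (W x).mat (W.avgMat (p.mix x t h0 h1.le)))
      ≤ W.holevoInfo (p.mix x t h0 h1.le) := by
  set q := p.mix x t h0 h1.le
  have hrange : LinearMap.range (W.avgMat p).mulVecLin ≤ LinearMap.range (W.avgMat q).mulVecLin := by
    refine range_le_of_posSemidef_sub (W.avgState p).posSemidef (W.avgState q).posSemidef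
      (sub_pos.2 h1) ?_
    change (W.avgMat q - (1 - t) • W.avgMat p).PosSemidef
    rw [W.avgMat_mix, add_sub_cancel_left]
    exact (W x).posSemidef.smul h0
  have h2 := traceLog_le_traceLog_self (ρ := W.avgState p) (σ := W.avgState q) hrange
  change traceLog (W.avgMat p) (W.avgMat q) ≤ traceLog (W.avgMat p) (W.avgMat p) at h2
  have h3 : traceLog (W.avgMat q) (W.avgMat q)
      = (1 - t) * traceLog (W.avgMat p) (W.avgMat q) + t * traceLog (W x).mat (W.avgMat q) := by
    rw [W.traceLog_avgMat q, p.linearCombination_mix, ← W.traceLog_avgMat p]; rfl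
  rw [Channel.holevoInfo, Channel.holevoInfo, h3, p.linearCombination_mix]
  simp only [smul_eq_mul]
  nlinarith [mul_le_mul_of_nonneg_left h2 (sub_nonneg.2 h1.le)]

theorem State.one_sub_posSemidef (ρ : State d) : (1 - ρ.mat).PosSemidef := by
  obtain ⟨U, a, hU, hU', ha, ha1, hρ⟩ := ρ.exists_conjDiag
  rw [hρ, ← conjDiag_one hU', conjDiag_sub]
  exact conjDiag_posSemidef U fun i => sub_nonneg.2
    (ha1 ▸ Finset.single_le_sum (fun j _ => ha j) (Finset.mem_univ i))

theorem State.nonempty (ρ : State d) : Nonempty d := by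
  by_contra h
  rw [not_nonempty_iff] at h
  simpa [trace] using ρ.trace_eq_one

/-- The mixture of a state with the maximally mixed state. -/
noncomputable def State.smooth (ρ : State d) (δ : ℝ) (h0 : 0 ≤ δ) (h1 : δ ≤ 1) : State d where
  mat := (1 - δ) • ρ.mat + (δ / Fintype.card d) • (1 : Matrix d d ℂ)
  posSemidef := (ρ.posSemidef.smul (sub_nonneg.2 h1)).add (PosSemidef.one.smul (by positivity))
  trace_eq_one := by
    have := ρ.nonempty
    have h : (Fintype.card d : ℂ) ≠ 0 := by exact_mod_cast Fintype.card_ne_zero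
    rw [trace_add, trace_smul, trace_smul, ρ.trace_eq_one, trace_one, ← Complex.coe_smul,
      ← Complex.coe_smul]
    simp only [smul_eq_mul, mul_one]
    push_cast
    field_simp
    ring

/-- If the Holevo information is bounded by `χ`, then some state of full rank has divergence at
most `χ + γ` from all outputs of the channel. -/
theorem Channel.exists_center [Nonempty X] {χ : ℝ} (hχ : IsLUB (Set.range W.holevoInfo) χ)
    {γ : ℝ} (hγ : 0 < γ) :
    ∃ (σ : State d) (β : ℝ), 0 < β ∧ (σ.mat - (β : ℂ) • 1).PosSemidef ∧
      ∀ x, traceLog (W x).mat (W x).mat - traceLog (W x).mat σ.mat ≤ χ + γ := by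
  have hd : Nonempty d := (W (Classical.arbitrary X)).nonempty
  have hD : (1 : ℝ) ≤ Fintype.card d := by exact_mod_cast Fintype.card_pos
  obtain ⟨δ, hδ0, hδ1, hδ⟩ : ∃ δ : ℝ, 0 < δ ∧ δ < 1 ∧ -Real.log (1 - δ) ≤ γ / 2 := by
    refine ⟨1 - Real.exp (-(γ / 2)), ?_, ?_, ?_⟩
    · rw [sub_pos, Real.exp_lt_one_iff]; linarith
    · linarith [Real.exp_pos (-(γ / 2))]
    · simp
  -- With `2 t = δ / card d`, the identity component added by `smooth` covers both `t • (W x).mat`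
  -- and the shift `t • 1` in the comparison below.
  set t : ℝ := δ / (2 * Fintype.card d)
  have ht0 : 0 < t := by positivity
  have ht2 : t + t = δ / Fintype.card d := by simp only [t]; field_simp; norm_num
  have ht1 : t < 1 := by
    have : δ / Fintype.card d ≤ δ := div_le_self hδ0.le hD
    linarith
  -- The gap is of order `t γ` because the bound on the divergence of `W x` is obtained after
  -- division by `t`.
  obtain ⟨_, ⟨p, rfl⟩, hp, -⟩ := hχ.exists_between (show χ - t * (γ / 2) < χ by
    have : 0 < t * (γ / 2) := by positivity
    linarith)
  refine ⟨(W.avgState p).smooth δ hδ0.le hδ1.le, δ / Fintype.card d, by positivity, ?_, ?_⟩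
  · rw [Complex.coe_smul]
    simp only [State.smooth, add_sub_cancel_right]
    exact (W.avgState p).posSemidef.smul (sub_nonneg.2 hδ1.le)
  · intro x
    set q := p.mix x t ht0.le ht1.le
    have hle := W.le_holevoInfo_mix p x ht0.le ht1
    have hq : W.holevoInfo q ≤ χ := hχ.1 ⟨q, rfl⟩
    have hD1 : traceLog (W x).mat (W x).mat - traceLog (W x).mat (W.avgMat q) ≤ χ + γ / 2 := by
      refine le_of_mul_le_mul_left ?_ ht0
      nlinarith [mul_lt_mul_of_pos_left hp (sub_pos.2 ht1), mul_pos ht0 (mul_pos ht0 hγ)]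
    have hrange : LinearMap.range (W x).mat.mulVecLin ≤ LinearMap.range (W.avgMat q).mulVecLin := by
      refine range_le_of_posSemidef_sub (W x).posSemidef (W.avgState q).posSemidef ht0 ?_
      rw [W.avgMat_mix, add_sub_cancel_right]
      exact (W.avgState p).posSemidef.smul (sub_nonneg.2 ht1.le)
    have h1δ : 0 < 1 - δ := sub_pos.2 hδ1
    -- The average state of `q` depends on `x`. The smoothed average state of `p` does not, and it
    -- dominates `(1 - δ)(ρ_q + t)` for every `x`; the replacement costs `-log (1 - δ) ≤ γ / 2`.
    have hlog := traceLog_add_log_le (ρ := W x) (σ := W.avgState q) hrange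
      (τ := ((W.avgState p).smooth δ hδ0.le hδ1.le).mat) (c := 1 - δ) (ε := t) h1δ ht0 (by
        have e : ((W.avgState p).smooth δ hδ0.le hδ1.le).mat
            - (1 - δ) • ((W.avgState q).mat + t • (1 : Matrix d d ℂ))
            = ((1 - δ) * t) • (W.avgState p).mat + ((1 - δ) * t) • (1 - (W x).mat)
              + (δ * (t + t)) • (1 : Matrix d d ℂ) := by
          have e1 : (W.avgState q).mat = (1 - t) • (W.avgState p).mat + t • (W x).mat :=
            W.avgMat_mix p x t ht0.le ht1.le
          rw [e1, State.smooth]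
          dsimp only
          rw [← ht2]
          module
        rw [e]
        exact (((W.avgState p).posSemidef.smul (by positivity)).add
          ((W x).one_sub_posSemidef.smul (by positivity))).add (PosSemidef.one.smul (by positivity)))
    change traceLog (W x).mat (W.avgMat q) + _ ≤ _ at hlog
    linarith

end Center

/-! ### The strong converse for codes -/

section StrongConverse

variable {X d : Type*} [Fintype d] [DecidableEq d] (W : Channel X d)

theorem Code.one_sub_povm_posSemidef {Y e : Type*} [Fintype e] [DecidableEq e] (c : Code Y e)
    (i : Fin c.M) : (1 - c.povm i).PosSemidef := by
  rw [← c.povm_sum, ← Finset.add_sum_erase _ _ (Finset.mem_univ i), add_sub_cancel_left]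
  exact posSemidef_sum _ fun j _ => c.povm_posSemidef j

theorem Code.avgError_eq {Y e : Type*} [Fintype e] [DecidableEq e] (c : Code Y e)
    (V : Channel Y e) :
    c.avgError V = 1 - (∑ i, ((V (c.enc i)).mat * c.povm i).trace.re) / c.M := by
  have : (c.M : ℝ) ≠ 0 := by exact_mod_cast c.M_pos.ne'
  rw [Code.avgError, Finset.sum_sub_distrib]
  simp
  field_simp

theorem Code.avgError_nonneg {Y e : Type*} [Fintype e] [DecidableEq e] (c : Code Y e)
    (V : Channel Y e) : 0 ≤ c.avgError V := by
  refine mul_nonneg (by positivity) (Finset.sum_nonneg fun i _ => ?_)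
  have h := re_trace_mul_nonneg (V (c.enc i)).posSemidef (c.one_sub_povm_posSemidef i)
  rwa [Matrix.mul_sub, Matrix.mul_one, trace_sub, Complex.sub_re, State.trace_eq_one,
    Complex.one_re] at h

theorem Code.avgError_le_one {Y e : Type*} [Fintype e] [DecidableEq e] (c : Code Y e)
    (V : Channel Y e) : c.avgError V ≤ 1 := by
  rw [c.avgError_eq]
  have : 0 ≤ (∑ i, ((V (c.enc i)).mat * c.povm i).trace.re) / c.M :=
    div_nonneg (Finset.sum_nonneg fun i _ =>
      re_trace_mul_nonneg (V (c.enc i)).posSemidef (c.povm_posSemidef i)) (Nat.cast_nonneg _)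
  linarith

/-- Each decoding operator is used as a test against the same state `σ^{⊗ n}`; their acceptance
probabilities there sum to `1`, so averaging over messages leaves `a / M`. -/
theorem Channel.one_sub_avgError_le {n : ℕ} (c : Code (Fin n → X) (Fin n → d)) (σ : State d)
    {β r s : ℝ} (hβ : 0 < β) (hσ : (σ.mat - (β : ℂ) • 1).PosSemidef)
    (hr : ∀ x, traceLog (W x).mat (W x).mat - traceLog (W x).mat σ.mat ≤ r)
    (hs : 0 ≤ s) (hsβ : s * -Real.log β ≤ 1) {ε a : ℝ} (hε : 0 < ε) (ha : 0 < a) :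
    1 - c.avgError (W.memoryless n)
      ≤ ε + Real.exp (-s * Real.log (ε * a)
          + n * (s * r + s ^ 2 * (8 * Fintype.card d + 2 * Real.log β ^ 2))) + a / c.M := by
  have hM : (0 : ℝ) < c.M := by exact_mod_cast c.M_pos
  set B := ε + Real.exp (-s * Real.log (ε * a)
          + n * (s * r + s ^ 2 * (8 * Fintype.card d + 2 * Real.log β ^ 2)))
  have h := fun i => trace_tensor_mul_le (fun k => W (c.enc i k)) σ hβ hσ (fun k => hr _) hs hsβ
    hε ha (c.povm_posSemidef i) (c.one_sub_povm_posSemidef i)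
  have hsum : ∑ i, ((State.tensor fun _ : Fin n => σ).mat * c.povm i).trace.re = 1 := by
    rw [← Complex.re_sum, ← trace_sum, ← Finset.mul_sum, c.povm_sum, Matrix.mul_one,
      State.trace_eq_one, Complex.one_re]
  rw [c.avgError_eq, sub_sub_cancel, div_le_iff₀ hM]
  calc _ ≤ ∑ i, (B + a * ((State.tensor fun _ : Fin n => σ).mat * c.povm i).trace.re) :=
        Finset.sum_le_sum fun i _ => h i
    _ = _ := by
        rw [Finset.sum_add_distrib, ← Finset.mul_sum, hsum]
        simp
        field_simp

/-- Codes of rate above the bound `χ` of the Holevo information have error tending to one. -/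
theorem Channel.tendsto_avgError_one [Nonempty X] {χ : ℝ} (hχ : IsLUB (Set.range W.holevoInfo) χ)
    {γ : ℝ} (hγ : 0 < γ) (c : ∀ n, Code (Fin n → X) (Fin n → d))
    (hc : ∀ᶠ n : ℕ in Filter.atTop, Real.exp (n * (χ + 6 * γ)) ≤ (c n).M) :
    Filter.Tendsto (fun n => (c n).avgError (W.memoryless n)) Filter.atTop (nhds 1) := by
  obtain ⟨σ, β, hβ, hσ, hr⟩ := W.exists_center hχ hγ
  set C : ℝ := 8 * Fintype.card d + 2 * Real.log β ^ 2
  have hC : 0 ≤ C := by positivity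
  obtain ⟨s, hs0, hsβ, hsC⟩ : ∃ s : ℝ, 0 < s ∧ s * -Real.log β ≤ 1 ∧ s * C ≤ γ := by
    have h1 : 0 < 1 + |Real.log β| + C / γ := by positivity
    refine ⟨(1 + |Real.log β| + C / γ)⁻¹, by positivity, ?_, ?_⟩
    · rw [inv_mul_le_iff₀ h1]
      have := neg_le_abs (Real.log β)
      have : 0 ≤ C / γ := by positivity
      linarith
    · rw [inv_mul_le_iff₀ h1, add_mul, div_mul_cancel₀ _ hγ.ne']
      have : 0 ≤ (1 + |Real.log β|) * γ := by positivity
      linarith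
  have hlim : ∀ k : ℝ, 0 < k →
      Filter.Tendsto (fun n : ℕ => Real.exp (-(n * k))) Filter.atTop (nhds 0) := fun k hk =>
    Real.tendsto_exp_neg_atTop_nhds_zero.comp
      (tendsto_natCast_atTop_atTop.atTop_mul_const hk)
  have hbound : ∀ᶠ n : ℕ in Filter.atTop, 1 - (Real.exp (-(n * γ)) + Real.exp (-(n * (s * γ)))
      + Real.exp (-(n * γ))) ≤ (c n).avgError (W.memoryless n) := by
    filter_upwards [hc] with n hn
    -- With `ε = exp (-nγ)` and `a = exp (n(χ + 5γ))` the threshold `ε a` has exponent `n(χ + 4γ)`,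
    -- above the mean bound `n(χ + γ)` by `3nγ`. The quadratic term uses up at most `nsγ` since `s C
    -- ≤ γ`, and `a / M ≤ exp (-nγ)`.
    have h := W.one_sub_avgError_le (c n) σ hβ hσ hr hs0.le hsβ
      (Real.exp_pos (-(n * γ))) (Real.exp_pos (n * (χ + 5 * γ)))
    have h1 : Real.exp (n * (χ + 5 * γ)) / (c n).M ≤ Real.exp (-(n * γ)) := by
      rw [div_le_iff₀ (by exact_mod_cast (c n).M_pos)]
      calc _ = Real.exp (-(n * γ)) * Real.exp (n * (χ + 6 * γ)) := by
            rw [← Real.exp_add]; ring_nf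
        _ ≤ _ := by gcongr
    have h2 : -s * Real.log (Real.exp (-(n * γ)) * Real.exp (n * (χ + 5 * γ)))
        + n * (s * (χ + γ) + s ^ 2 * C) ≤ -(n * (s * γ)) := by
      rw [← Real.exp_add, Real.log_exp]
      have : (n : ℝ) * s * (s * C) ≤ n * s * γ := by gcongr
      nlinarith [mul_nonneg (mul_nonneg n.cast_nonneg hs0.le) hγ.le]
    have h3 := Real.exp_le_exp.2 h2
    linarith
  refine tendsto_of_tendsto_of_tendsto_of_le_of_le' ?_ tendsto_const_nhds hbound
    (Filter.Eventually.of_forall fun n => (c n).avgError_le_one _)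
  have := (((hlim γ hγ).add (hlim (s * γ) (by positivity))).add (hlim γ hγ)).const_sub 1
  simpa using this

end StrongConverse

/-! ### The Hayashi–Nagaoka inequality and random coding -/

section HayashiNagaoka

variable {ι : Type*} [Fintype ι] [DecidableEq ι]

/-- The square root is operator monotone. -/
theorem sub_posSemidef_of_sq_le_sq {S C : Matrix ι ι ℂ} (hS : S.PosSemidef) (hC : C.PosSemidef)
    (h : (C * C - S * S).PosSemidef) : (C - S).PosSemidef := by
  open scoped Matrix.Norms.L2Operator MatrixOrder in
  have h1 : CFC.sqrt (S * S) = S := CFC.sqrt_mul_self S hS.nonneg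
  have h2 : CFC.sqrt (C * C) = C := CFC.sqrt_mul_self C hC.nonneg
  have h3 := CFC.monotone_sqrt (Matrix.le_iff.2 h)
  rw [h1, h2] at h3
  exact Matrix.le_iff.1 h3

/-- The Hayashi–Nagaoka inequality, for `Q = (S + R)^{-1/2}`. -/
theorem hayashi_nagaoka {S R Q C : Matrix ι ι ℂ} (hS : S.PosSemidef) (hS' : (1 - S).PosSemidef)
    (hR : R.PosSemidef) (hQ : Q.IsHermitian) (hC : C.PosSemidef) (hCC : C * C = S + R)
    (hQC : Q * C = 1) (hCQ : C * Q = 1) :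
    ((2 : ℝ) • (1 - S) + (4 : ℝ) • R - (1 - Q * S * Q)).PosSemidef := by
  -- `C² = S + R ≥ S ≥ S²`.
  have h1 : (C - S).PosSemidef := sub_posSemidef_of_sq_le_sq hS hC (by
    have : C * C - S * S = (S - S * S) + R := by rw [hCC]; abel
    rw [this]
    exact (posSemidef_sub_mul_self hS hS').add hR)
  have hR' : R = C * C - S := by rw [hCC]; abel
  have hQA : Q * (C * C) = C := by rw [← Matrix.mul_assoc, hQC, Matrix.one_mul]
  have hAQ : (C * C) * Q = C := by rw [Matrix.mul_assoc, hCQ, Matrix.mul_one]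
  -- The claimed difference equals `(Q - 2) R (Q - 2) + 2 (Q - 1) S (Q - 1) + 4 (C - S)`, a sum of
  -- positive semidefinite matrices.
  have h2 := (hR.conjTranspose_mul_mul_same (Q - (2 : ℝ) • 1)).add
    (((hS.conjTranspose_mul_mul_same (Q - 1)).smul zero_le_two (α := ℝ)).add
      (h1.smul (zero_le_four (α := ℝ))))
  have e1 : (Q - (2 : ℝ) • 1)ᴴ = Q - (2 : ℝ) • 1 := by
    rw [conjTranspose_sub, hQ.eq, conjTranspose_smul, conjTranspose_one, star_trivial]
  have e2 : (Q - 1)ᴴ = Q - 1 := by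
    rw [conjTranspose_sub, hQ.eq, conjTranspose_one]
  rw [e1, e2] at h2
  convert h2 using 1
  have e3 : (Q - (2 : ℝ) • 1) * R * (Q - (2 : ℝ) • 1)
      = 1 - (4 : ℝ) • C + (4 : ℝ) • (C * C) - (Q * S * Q - (2 : ℝ) • (Q * S) - (2 : ℝ) • (S * Q)
        + (4 : ℝ) • S) := by
    rw [hR']
    simp only [Matrix.sub_mul, Matrix.mul_sub, Matrix.smul_mul, Matrix.mul_smul, Matrix.one_mul,
      Matrix.mul_one, hQA, hAQ, hCQ]
    module
  rw [e3]
  simp only [Matrix.sub_mul, Matrix.mul_sub, Matrix.one_mul, Matrix.mul_one]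
  rw [hR']
  module

theorem exists_inv_sqrt {A : Matrix ι ι ℂ} (hA : A.PosSemidef) {η : ℝ} (hη : 0 < η) :
    ∃ Q C : Matrix ι ι ℂ, Q.PosSemidef ∧ C.PosSemidef ∧ C * C = A + η • (1 : Matrix ι ι ℂ) ∧
      Q * C = 1 ∧ C * Q = 1 := by
  obtain ⟨U, a, hU, hU', ha, rfl⟩ := exists_conjDiag hA
  have hpos : ∀ i, 0 < a i + η := fun i => by linarith [ha i]
  refine ⟨conjDiag U fun i => (√(a i + η))⁻¹, conjDiag U fun i => √(a i + η),
    conjDiag_posSemidef U fun i => by positivity, conjDiag_posSemidef U fun i => by positivity,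
    ?_, ?_, ?_⟩
  · rw [conjDiag_mul hU, ← conjDiag_one hU', conjDiag_smul_real, conjDiag_add]
    congr 1
    funext i
    rw [Real.mul_self_sqrt (hpos i).le, mul_one]
  all_goals
    rw [conjDiag_mul hU, ← conjDiag_one hU']
    congr 1
    funext i
    have := (Real.sqrt_pos.2 (hpos i)).ne'
    field_simp

/-- Decoding by the pretty good measurement of given tests. -/
theorem exists_code_of_tests {Y : Type*} (V : Channel Y ι) {M : ℕ} (hM : 0 < M) (enc : Fin M → Y)
    (T : Fin M → Matrix ι ι ℂ) (hT : ∀ i, (T i).PosSemidef) (hT' : ∀ i, (1 - T i).PosSemidef)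
    {η : ℝ} (hη : 0 < η) :
    ∃ c : Code Y ι, c.M = M ∧ c.avgError V ≤ (1 / (M : ℝ)) * ∑ i,
      (2 * ((V (enc i)).mat * (1 - T i)).trace.re
        + 4 * ∑ j ∈ Finset.univ.erase i, ((V (enc i)).mat * T j).trace.re + 4 * η) := by
  obtain ⟨Q, C, hQ, hC, hCC, hQC, hCQ⟩ :=
    exists_inv_sqrt (posSemidef_sum Finset.univ fun i _ => hT i) hη
  have hsand : ∀ {A : Matrix ι ι ℂ}, A.PosSemidef → (Q * A * Q).PosSemidef := fun {A} hA => by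
    have := hA.conjTranspose_mul_mul_same Q
    rwa [hQ.isHermitian.eq] at this
  have hid : (η • (1 : Matrix ι ι ℂ)).PosSemidef := PosSemidef.one.smul hη.le
  -- Adding `η` makes the sum of the tests invertible. The remainder `η Q²` goes to message `0`, so
  -- that the POVM sums to `1`; it can only raise the success probability.
  have hrest : ∀ i : Fin M, (Q * (if i = ⟨0, hM⟩ then η • (1 : Matrix ι ι ℂ) else 0) * Q).PosSemidef :=
    fun i => by
      split_ifs
      · exact hsand hid
      · simpa using PosSemidef.zero
  refine ⟨⟨M, hM, enc, fun i => Q * T i * Q + Q * (if i = ⟨0, hM⟩ then η • 1 else 0) * Q,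
    fun i => (hsand (hT i)).add (hrest i), ?_⟩, rfl, ?_⟩
  · rw [Finset.sum_add_distrib, ← Finset.sum_mul, ← Finset.mul_sum, ← Finset.sum_mul,
      ← Finset.mul_sum, ← Matrix.add_mul, ← Matrix.mul_add, Finset.sum_ite_eq',
      if_pos (Finset.mem_univ _), ← hCC, ← Matrix.mul_assoc, hQC, Matrix.one_mul, hCQ]
  · refine mul_le_mul_of_nonneg_left (Finset.sum_le_sum fun i _ => ?_) (by positivity)
    -- Counting `η • 1` with the competing tests is what produces the error term `4 η`.
    set R := ∑ j ∈ Finset.univ.erase i, T j + η • (1 : Matrix ι ι ℂ)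
    have hR : R.PosSemidef := (posSemidef_sum _ fun j _ => hT j).add hid
    have hSR : C * C = T i + R := by
      rw [hCC, ← Finset.add_sum_erase _ _ (Finset.mem_univ i), add_assoc]
    have h1 := re_trace_mul_nonneg (V (enc i)).posSemidef
      (hayashi_nagaoka (hT i) (hT' i) hR hQ.isHermitian hC hSR hQC hCQ)
    have h2 := re_trace_mul_nonneg (V (enc i)).posSemidef (hrest i)
    have h3 : ((V (enc i)).mat).trace.re = 1 := by rw [State.trace_eq_one, Complex.one_re]
    simp only [R, Matrix.mul_sub, Matrix.mul_add, Matrix.mul_smul, Matrix.mul_one, trace_sub,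
      trace_add, trace_smul, Complex.sub_re, Complex.add_re, Complex.real_smul,
      Complex.re_ofReal_mul, h3, Finset.mul_sum, trace_sum, Complex.re_sum] at h1 h2 ⊢
    rw [← Finset.mul_sum]
    linarith

end HayashiNagaoka

/-! ### Averages over independent random codewords. -/

section RandomCoding

variable {Y : Type*} [Fintype Y] {M : ℕ}

theorem sum_prod_mul_apply {w : Y → ℝ} (hw : ∑ y, w y = 1) (i : Fin M) (g : Y → ℝ) :
    ∑ c : Fin M → Y, (∏ k, w (c k)) * g (c i) = ∑ y, w y * g y := by
  classical
  have h1 : ∀ c : Fin M → Y, (∏ k, w (c k)) * g (c i)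
      = ∏ k, w (c k) * (if k = i then g (c k) else 1) := fun c => by
    rw [Finset.prod_mul_distrib, Finset.prod_ite_eq' Finset.univ i, if_pos (Finset.mem_univ i)]
  simp only [h1]
  rw [← Fintype.prod_sum fun k y => w y * (if k = i then g y else 1),
    Finset.prod_eq_single i]
  · simp
  · intro k _ hk
    simp [hk, hw]
  · simp

theorem sum_prod_mul_apply_mul_apply {w : Y → ℝ} (hw : ∑ y, w y = 1) {i j : Fin M} (hij : i ≠ j)
    (g g' : Y → ℝ) :
    ∑ c : Fin M → Y, (∏ k, w (c k)) * (g (c i) * g' (c j))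
      = (∑ y, w y * g y) * ∑ y, w y * g' y := by
  classical
  have h1 : ∀ c : Fin M → Y, (∏ k, w (c k)) * (g (c i) * g' (c j))
      = ∏ k, w (c k) * ((if k = i then g (c k) else 1) * (if k = j then g' (c k) else 1)) :=
    fun c => by
      rw [Finset.prod_mul_distrib, Finset.prod_mul_distrib, Finset.prod_ite_eq' Finset.univ i,
        if_pos (Finset.mem_univ i), Finset.prod_ite_eq' Finset.univ j, if_pos (Finset.mem_univ j)]
  simp only [h1]
  rw [← Fintype.prod_sum fun k y => w y * ((if k = i then g y else 1) * (if k = j then g' y else 1)),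
    ← Finset.mul_prod_erase _ _ (Finset.mem_univ i),
    ← Finset.mul_prod_erase _ _ (Finset.mem_erase.2 ⟨hij.symm, Finset.mem_univ j⟩),
    Finset.prod_eq_one]
  · simp [hij, hij.symm]
  · intro k hk
    simp only [Finset.mem_erase, Finset.mem_univ, and_true] at hk
    simp [hk.1, hk.2, hw]

theorem exists_le_of_weighted_sum_le {Ω : Type*} [Fintype Ω] {w F : Ω → ℝ} {B : ℝ}
    (hw : ∀ c, 0 ≤ w c) (hw1 : ∑ c, w c = 1) (h : ∑ c, w c * F c ≤ B) : ∃ c, F c ≤ B := by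
  by_contra! hcon
  obtain ⟨c, -, hc⟩ : ∃ c ∈ Finset.univ, (0 : ℝ) < w c :=
    Finset.exists_lt_of_sum_lt (by simp [hw1])
  have : ∑ c, w c * B < ∑ c, w c * F c :=
    Finset.sum_lt_sum (fun c _ => mul_le_mul_of_nonneg_left (hcon c).le (hw c))
      ⟨c, Finset.mem_univ c, mul_lt_mul_of_pos_left (hcon c) hc⟩
  rw [← Finset.sum_mul, hw1, one_mul] at this
  linarith

/-- Random coding: a bound on the error of the best code with codewords drawn from `Y`. -/
theorem exists_code_of_average {Z e : Type*} [Fintype e] [DecidableEq e] (V : Channel Z e)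
    (f : Y → Z) {w : Y → ℝ} (hw : ∀ y, 0 ≤ w y) (hw1 : ∑ y, w y = 1) (T : Y → Matrix e e ℂ)
    (hT : ∀ y, (T y).PosSemidef) (hT' : ∀ y, (1 - T y).PosSemidef) {ε τ η : ℝ}
    (hε : ∑ y, w y * ((V (f y)).mat * (1 - T y)).trace.re ≤ ε)
    (hτ : ∀ y', ∑ y, w y * ((V (f y)).mat * T y').trace.re ≤ τ) (hη : 0 < η) (hM : 0 < M) :
    ∃ c : Code Z e, c.M = M ∧ c.avgError V ≤ 2 * ε + 4 * ((M - 1) * τ) + 4 * η := by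
  classical
  have hM0 : (M : ℝ) ≠ 0 := by exact_mod_cast hM.ne'
  set h : Y → Y → ℝ := fun y y' => ((V (f y)).mat * T y').trace.re
  set g : Y → ℝ := fun y => ((V (f y)).mat * (1 - T y)).trace.re
  have hwc : ∑ c : Fin M → Y, ∏ k, w (c k) = 1 := by
    rw [← Fintype.prod_sum]; simp [hw1]
  have hpair : ∀ i j : Fin M, i ≠ j →
      ∑ c : Fin M → Y, (∏ k, w (c k)) * h (c i) (c j) ≤ τ := by
    intro i j hij
    -- The value of `c j` is fixed by an indicator, so independence applies and the uniform bound
    -- `hτ` handles the average over `c i`.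
    calc _ = ∑ c : Fin M → Y, ∑ y', (∏ k, w (c k)) * (h (c i) y' * if c j = y' then 1 else 0) := by
            refine Finset.sum_congr rfl fun c _ => ?_
            rw [← Finset.mul_sum]
            simp
      _ = ∑ y', (∑ y, w y * h y y') * w y' := by
            rw [Finset.sum_comm]
            refine Finset.sum_congr rfl fun y' _ => ?_
            rw [sum_prod_mul_apply_mul_apply hw1 hij (fun y => h y y')
              (fun y => if y = y' then 1 else 0)]
            simp
      _ ≤ ∑ y', τ * w y' := Finset.sum_le_sum fun y' _ =>
            mul_le_mul_of_nonneg_right (hτ y') (hw y')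
      _ = τ := by rw [← Finset.mul_sum, hw1, mul_one]
  obtain ⟨c, hc⟩ := exists_le_of_weighted_sum_le (w := fun c : Fin M → Y => ∏ k, w (c k))
    (F := fun c => (1 / (M : ℝ)) * ∑ i,
      (2 * g (c i) + 4 * ∑ j ∈ Finset.univ.erase i, h (c i) (c j) + 4 * η))
    (B := 2 * ε + 4 * ((M - 1) * τ) + 4 * η)
    (fun c => Finset.prod_nonneg fun k _ => hw _) hwc (by
      calc _ = (1 / (M : ℝ)) * ∑ i : Fin M, (2 * (∑ c : Fin M → Y, (∏ k, w (c k)) * g (c i))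
            + 4 * (∑ j ∈ Finset.univ.erase i, ∑ c : Fin M → Y, (∏ k, w (c k)) * h (c i) (c j))
            + 4 * η * ∑ c : Fin M → Y, ∏ k, w (c k)) := by
              simp only [mul_left_comm _ (1 / (M : ℝ)), ← Finset.mul_sum]
              congr 1
              simp only [Finset.mul_sum]
              rw [Finset.sum_comm]
              refine Finset.sum_congr rfl fun i _ => ?_
              rw [Finset.sum_comm (s := Finset.univ.erase i), ← Finset.sum_add_distrib,
                ← Finset.sum_add_distrib]
              refine Finset.sum_congr rfl fun c _ => ?_
              rw [← Finset.mul_sum, ← Finset.mul_sum, ← Finset.mul_sum]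
              ring
        _ ≤ (1 / (M : ℝ)) * ∑ _i : Fin M, (2 * ε + 4 * ((M - 1) * τ) + 4 * η) := by
              refine mul_le_mul_of_nonneg_left (Finset.sum_le_sum fun i _ => ?_) (by positivity)
              rw [sum_prod_mul_apply hw1, hwc, mul_one]
              have h2 : ∑ j ∈ Finset.univ.erase i, ∑ c : Fin M → Y, (∏ k, w (c k)) * h (c i) (c j)
                  ≤ (M - 1) * τ := by
                refine (Finset.sum_le_card_nsmul _ _ τ fun j hj =>
                  hpair i j (Finset.ne_of_mem_erase hj).symm).trans (le_of_eq ?_)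
                rw [Finset.card_erase_of_mem (Finset.mem_univ i), Finset.card_univ,
                  Fintype.card_fin, nsmul_eq_mul, Nat.cast_pred hM]
              linarith
        _ = _ := by
              rw [Finset.sum_const, Finset.card_univ, Fintype.card_fin, nsmul_eq_mul]
              field_simp)
  obtain ⟨code, hcM, hce⟩ := exists_code_of_tests V hM (fun i => f (c i)) (fun i => T (c i))
    (fun i => hT _) (fun i => hT' _) hη
  exact ⟨code, hcM, hce.trans hc⟩

end RandomCoding

/-! ### Typicality and the direct part -/

section Chernoff

variable {Ω : Type*} [Fintype Ω]

/-- The weak law of large numbers for a finite distribution. -/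
theorem tendsto_sum_large_deviation {q Z : Ω → ℝ} (hq : ∀ ω, 0 ≤ q ω) (hq1 : ∑ ω, q ω = 1) {z : ℝ}
    (hz : ∑ ω, q ω * Z ω < z) :
    Filter.Tendsto (fun n : ℕ => ∑ w : Fin n → Ω,
      if n * z < ∑ k, Z (w k) then ∏ k, q (w k) else 0) Filter.atTop (nhds 0) := by
  set m : ℝ := z - ∑ ω, q ω * Z ω with hm
  have hm0 : 0 < m := sub_pos.2 hz
  set v : ℝ := ∑ ω, q ω * (Z ω - z) ^ 2
  have hv : 0 ≤ v := Finset.sum_nonneg fun ω _ => mul_nonneg (hq ω) (sq_nonneg _)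
  set K : ℝ := ∑ ω, |Z ω - z|
  have hK : 0 ≤ K := Finset.sum_nonneg fun ω _ => abs_nonneg _
  -- `s K ≤ 1` keeps all exponents in the range of the quadratic bound; `s v ≤ m / 2` lets the
  -- linear decrease `s m` beat the quadratic term, so `φ < 1`.
  obtain ⟨s, hs0, hs1, hs2⟩ : ∃ s : ℝ, 0 < s ∧ s * K ≤ 1 ∧ s * v ≤ m / 2 := by
    have h1 : 0 < 1 + K + v / (m / 2) := by positivity
    refine ⟨(1 + K + v / (m / 2))⁻¹, by positivity, ?_, ?_⟩
    · rw [inv_mul_le_iff₀ h1]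
      have : 0 ≤ v / (m / 2) := by positivity
      linarith
    · rw [inv_mul_le_iff₀ h1, add_mul, div_mul_cancel₀ _ (by positivity)]
      have : 0 ≤ (1 + K) * (m / 2) := by positivity
      linarith
  set φ : ℝ := ∑ ω, q ω * Real.exp (s * (Z ω - z))
  have hφ0 : 0 ≤ φ := Finset.sum_nonneg fun ω _ => mul_nonneg (hq ω) (Real.exp_nonneg _)
  have hφ : φ < 1 := by
    calc φ ≤ ∑ ω, q ω * (1 + s * (Z ω - z) + (s * (Z ω - z)) ^ 2) := by
          refine Finset.sum_le_sum fun ω _ => mul_le_mul_of_nonneg_left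
            (exp_le_one_add_add_sq (le_trans ?_ hs1)) (hq ω)
          exact mul_le_mul_of_nonneg_left ((le_abs_self _).trans
            (Finset.single_le_sum (f := fun ω => |Z ω - z|) (fun ω _ => abs_nonneg _)
              (Finset.mem_univ ω))) hs0.le
      _ = ∑ ω, (q ω + s * (q ω * Z ω) - s * z * q ω + s ^ 2 * (q ω * (Z ω - z) ^ 2)) :=
          Finset.sum_congr rfl fun ω _ => by ring
      _ = 1 - s * m + s * (s * v) := by
          rw [Finset.sum_add_distrib, Finset.sum_sub_distrib, Finset.sum_add_distrib,
            ← Finset.mul_sum, ← Finset.mul_sum, ← Finset.mul_sum, hq1, hm]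
          ring
      _ < 1 := by nlinarith [mul_pos hs0 hm0, mul_le_mul_of_nonneg_left hs2 hs0.le]
  refine squeeze_zero (fun n => Finset.sum_nonneg fun w _ => ?_) (fun n => ?_)
    (tendsto_pow_atTop_nhds_zero_of_lt_one hφ0 hφ)
  · split_ifs
    · exact Finset.prod_nonneg fun k _ => hq _
    · exact le_rfl
  · calc _ ≤ ∑ w : Fin n → Ω, ∏ k, q (w k) * Real.exp (s * (Z (w k) - z)) := by
          refine Finset.sum_le_sum fun w _ => ?_
          have hnn : 0 ≤ ∏ k, q (w k) := Finset.prod_nonneg fun k _ => hq _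
          rw [Finset.prod_mul_distrib, ← Real.exp_sum, ← Finset.mul_sum, Finset.sum_sub_distrib]
          split_ifs with h
          · refine le_mul_of_one_le_right hnn (Real.one_le_exp (mul_nonneg hs0.le ?_))
            simpa using h.le
          · positivity
      _ = φ ^ n := by
          rw [← Fintype.prod_sum fun _ ω => q ω * Real.exp (s * (Z ω - z))]
          simp [φ]

end Chernoff

/-! ### Tests from spectral projections. -/

section TypicalTest

variable {ι : Type*} [Fintype ι] [DecidableEq ι]

/-- The spectral projection of `U diag(a) Uᴴ` for the eigenvalues satisfying `p`. -/
noncomputable def specProj (U : Matrix ι ι ℂ) (p : ι → Prop) [DecidablePred p] : Matrix ι ι ℂ :=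
  conjDiag U fun i => if p i then 1 else 0

theorem specProj_posSemidef (U : Matrix ι ι ℂ) (p : ι → Prop) [DecidablePred p] :
    (specProj U p).PosSemidef :=
  conjDiag_posSemidef U fun i => by split_ifs <;> norm_num

theorem specProj_mul_self {U : Matrix ι ι ℂ} (hU : Uᴴ * U = 1) (p : ι → Prop) [DecidablePred p] :
    specProj U p * specProj U p = specProj U p := by
  rw [specProj, conjDiag_mul hU]
  congr 1
  funext i
  split_ifs <;> simp

theorem one_sub_specProj {U : Matrix ι ι ℂ} (hU : U * Uᴴ = 1) (p : ι → Prop) [DecidablePred p] :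
    1 - specProj U p = specProj U fun i => ¬ p i := by
  rw [specProj, specProj, ← conjDiag_one hU, conjDiag_sub]
  congr 1
  funext i
  by_cases h : p i <;> simp [h]

theorem trace_conjDiag_mul_specProj {U : Matrix ι ι ℂ} (hU : Uᴴ * U = 1) (a : ι → ℝ)
    (p : ι → Prop) [DecidablePred p] :
    (conjDiag U a * specProj U p).trace.re = ∑ i, if p i then a i else 0 := by
  rw [specProj, conjDiag_mul hU, trace_conjDiag hU, Complex.re_sum]
  simp

/-- The test `P Q P`, for projections `P` and `Q`. -/
theorem sandwich_posSemidef {P Q : Matrix ι ι ℂ} (hP : P.PosSemidef) (hQ : Q.PosSemidef) :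
    (P * Q * P).PosSemidef := by
  have := hQ.conjTranspose_mul_mul_same P
  rwa [hP.isHermitian.eq] at this

theorem one_sub_sandwich_posSemidef {P Q : Matrix ι ι ℂ} (hP : P.PosSemidef) (hPP : P * P = P)
    (hP' : (1 - P).PosSemidef) (hQ' : (1 - Q).PosSemidef) : (1 - P * Q * P).PosSemidef := by
  have : 1 - P * Q * P = (1 - P) + P * (1 - Q) * P := by
    rw [Matrix.mul_sub, Matrix.sub_mul, Matrix.mul_one, hPP]; abel
  rw [this]
  exact hP'.add (sandwich_posSemidef hP hQ')

/-- The operator inequality `1 - P Q P ≤ 3 (1 - P) + 2 (1 - Q)`: the difference is `(2 - P)(1 - Q)(2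
- P) + 2 (1 - P) Q (1 - P)`. -/
theorem trace_mul_one_sub_sandwich_le {ρ P Q : Matrix ι ι ℂ} (hρ : ρ.PosSemidef)
    (hPP : P * P = P) (hP' : (1 - P).PosSemidef) (hQ : Q.PosSemidef)
    (hQ' : (1 - Q).PosSemidef) :
    (ρ * (1 - P * Q * P)).trace.re
      ≤ 3 * (ρ * (1 - P)).trace.re + 2 * (ρ * (1 - Q)).trace.re := by
  have h1 := hQ'.conjTranspose_mul_mul_same (1 + (1 - P))
  rw [conjTranspose_add, conjTranspose_one, hP'.isHermitian.eq] at h1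
  have h2 := sandwich_posSemidef hP' hQ
  have h3 := re_trace_mul_nonneg hρ (h1.add (h2.smul (zero_le_two (α := ℝ))))
  have e : (1 + (1 - P)) * (1 - Q) * (1 + (1 - P)) + (2 : ℝ) • ((1 - P) * Q * (1 - P))
      = (3 : ℝ) • (1 - P) + (2 : ℝ) • (1 - Q) - (1 - P * Q * P) := by
    simp only [Matrix.add_mul, Matrix.mul_add, Matrix.sub_mul, Matrix.mul_sub, Matrix.one_mul,
      Matrix.mul_one, hPP]
    module
  rw [e, Matrix.mul_sub, Matrix.mul_add, Matrix.mul_smul, Matrix.mul_smul, trace_sub, trace_add,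
    trace_smul, trace_smul, Complex.sub_re, Complex.add_re, Complex.real_smul, Complex.real_smul,
    Complex.re_ofReal_mul, Complex.re_ofReal_mul] at h3
  linarith

/-- The test built from the large eigenvalues of `ρ` and the small eigenvalues of `σ` accepts `σ`
with small probability. -/
theorem trace_mul_typical_le {U V : Matrix ι ι ℂ} (hU : Uᴴ * U = 1) (hV : Vᴴ * V = 1)
    (hV' : V * Vᴴ = 1) {a b : ι → ℝ} (ha : ∀ i, 0 ≤ a i) (ha1 : ∑ i, a i = 1)
    {A B : ℝ} (hA : 0 < A) (hB : 0 ≤ B) :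
    (conjDiag V b * (specProj V (fun j => b j ≤ B) * specProj U (fun i => A ≤ a i)
      * specProj V (fun j => b j ≤ B))).trace.re ≤ B / A := by
  set P := specProj V (fun j => b j ≤ B)
  set Q := specProj U (fun i => A ≤ a i)
  have e : (conjDiag V b * (P * Q * P)).trace = ((P * conjDiag V b * P) * Q).trace := by
    rw [← Matrix.mul_assoc, trace_mul_comm]
    simp only [Matrix.mul_assoc]
  -- `P σ P ≤ B`, while at most `1 / A` eigenvalues of a state reach `A`. Hence `Tr (P σ P) Q ≤ B Tr
  -- Q ≤ B / A`.
  have h1 : (B • (1 : Matrix ι ι ℂ) - P * conjDiag V b * P).PosSemidef := by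
    rw [← conjDiag_one hV', conjDiag_smul_real]
    simp only [P, specProj]
    rw [conjDiag_mul hV, conjDiag_mul hV, conjDiag_sub]
    refine conjDiag_posSemidef V fun j => ?_
    by_cases h : b j ≤ B
    · simp [h]
    · simpa [h] using hB
  have h2 := re_trace_mul_nonneg h1 (specProj_posSemidef U fun i => A ≤ a i)
  rw [Matrix.sub_mul, trace_sub, Complex.sub_re, Matrix.smul_mul, Matrix.one_mul, trace_smul,
    Complex.real_smul, Complex.re_ofReal_mul] at h2
  have h3 : (specProj U fun i => A ≤ a i).trace.re ≤ 1 / A := by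
    rw [specProj, trace_conjDiag hU, Complex.re_sum, le_div_iff₀ hA, Finset.sum_mul]
    refine (Finset.sum_le_sum fun i _ => ?_).trans ha1.le
    rw [Complex.ofReal_re]
    split_ifs with h
    · simpa using h
    · simpa using ha i
  rw [e]
  calc _ ≤ B * (specProj U fun i => A ≤ a i).trace.re := by linarith
    _ ≤ B * (1 / A) := by gcongr
    _ = B / A := by ring

end TypicalTest

/-! ### Achievability below the Holevo information. -/

section Direct

variable {X d : Type*} [Fintype d] [DecidableEq d] (W : Channel X d)

theorem Channel.sum_memoryless (p : FinDist X) (n : ℕ) :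
    ∑ y : Fin n → p.prob.support, (∏ k, p.prob (y k)) •
        (W.memoryless n fun k => (y k : X)).mat
      = (State.tensor fun _ : Fin n => W.avgState p).mat := by
  ext i j
  have h1 : ∀ i j, (W.avgState p).mat i j
      = ∑ x : p.prob.support, (p.prob x : ℂ) * (W x).mat i j := fun i j => by
    change (W.avgMat p) i j = _
    rw [Channel.avgMat, p.linearCombination_eq_sum, Matrix.sum_apply]
    simp
  simp only [Channel.memoryless, State.tensor, tensorMat, Matrix.sum_apply, Matrix.smul_apply,
    of_apply, h1, Complex.real_smul, Complex.ofReal_prod, ← Finset.prod_mul_distrib]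
  exact (Fintype.prod_sum fun (k : Fin n) (x : p.prob.support) =>
    (p.prob x : ℂ) * (W x).mat (i k) (j k)).symm

theorem Channel.sum_trace_memoryless_mul (p : FinDist X) (n : ℕ)
    (T : Matrix (Fin n → d) (Fin n → d) ℂ) :
    ∑ y : Fin n → p.prob.support, (∏ k, p.prob (y k)) *
        ((W.memoryless n fun k => (y k : X)).mat * T).trace.re
      = ((State.tensor fun _ : Fin n => W.avgState p).mat * T).trace.re := by
  rw [← W.sum_memoryless, Finset.sum_mul, trace_sum, Complex.re_sum]
  refine Finset.sum_congr rfl fun y _ => ?_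
  rw [Matrix.smul_mul, trace_smul, Complex.real_smul, Complex.re_ofReal_mul]

/-- Tests that recognize the outputs of random words and accept the average output with
exponentially small probability. -/
theorem Channel.exists_tests (p : FinDist X) {r : ℝ} (hr : r < W.holevoInfo p) :
    ∃ T : ∀ n, (Fin n → p.prob.support) → Matrix (Fin n → d) (Fin n → d) ℂ,
      (∀ n y, (T n y).PosSemidef) ∧ (∀ n y, (1 - T n y).PosSemidef) ∧
      (∀ n y, ((State.tensor fun _ : Fin n => W.avgState p).mat * T n y).trace.re
        ≤ Real.exp (-(n * r))) ∧
      Filter.Tendsto (fun n => ∑ y : Fin n → p.prob.support, (∏ k, p.prob (y k)) *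
        ((W.memoryless n fun k => (y k : X)).mat * (1 - T n y)).trace.re)
        Filter.atTop (nhds 0) := by
  choose U a hU hU' ha ha1 hW using fun x => (W x).exists_conjDiag
  obtain ⟨V, b, hV, hV', hb, hb1, hσ⟩ := (W.avgState p).exists_conjDiag
  set γ : ℝ := (W.holevoInfo p - r) / 2
  have hγ : 0 < γ := by simp only [γ]; linarith
  -- `α` is the mean output entropy plus `γ` and `β` the entropy of the average state minus `γ`. The
  -- margins make both deviation events untypical, and `β - α` is the Holevo information minus `2γ`,
  -- that is `r`.
  set α : ℝ := -(∑ x : p.prob.support, p.prob x * ∑ i, a x i * Real.log (a x i)) + γ with hα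
  set β : ℝ := -(∑ j, b j * Real.log (b j)) - γ with hβ
  have hαβ : β - α = r := by
    have e1 : W.holevoInfo p = (∑ x : p.prob.support, p.prob x * ∑ i, a x i * Real.log (a x i))
        - ∑ j, b j * Real.log (b j) := by
      change _ - traceLog (W.avgState p).mat (W.avgState p).mat = _
      rw [p.linearCombination_eq_sum, hσ, traceLog_conjDiag_self hV hV']
      simp only [hW, traceLog_conjDiag_self (hU _) (hU' _), smul_eq_mul]
    rw [hα, hβ]
    simp only [γ]
    linarith
  have eσ : ∀ n, (State.tensor fun _ : Fin n => W.avgState p).mat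
      = conjDiag (tensorMat fun _ => V) fun w : Fin n → d => ∏ k, b (w k) := fun n => by
    simp only [State.tensor, hσ, tensorMat_conjDiag (fun _ => V) (fun _ => b)]
  have eW : ∀ n (y : Fin n → p.prob.support), (W.memoryless n fun k => (y k : X)).mat
      = conjDiag (tensorMat fun k => U (y k)) fun w : Fin n → d => ∏ k, a (y k) (w k) :=
    fun n y => by
      simp only [Channel.memoryless, State.tensor, hW, tensorMat_conjDiag]
  have hVn : ∀ n, (tensorMat fun _ : Fin n => V)ᴴ * tensorMat (fun _ : Fin n => V) = 1 := fun n =>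
    tensorMat_conjTranspose_mul_self fun _ => hV
  have hVn' : ∀ n, tensorMat (fun _ : Fin n => V) * (tensorMat fun _ : Fin n => V)ᴴ = 1 :=
    fun n => tensorMat_mul_conjTranspose_self fun _ => hV'
  have hUn : ∀ n (y : Fin n → p.prob.support),
      (tensorMat fun k => U (y k))ᴴ * tensorMat (fun k => U (y k)) = 1 := fun n y =>
    tensorMat_conjTranspose_mul_self fun _ => hU _
  have hUn' : ∀ n (y : Fin n → p.prob.support),
      tensorMat (fun k => U (y k)) * (tensorMat fun k => U (y k))ᴴ = 1 := fun n y =>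
    tensorMat_mul_conjTranspose_self fun _ => hU' _
  set P : ∀ n : ℕ, Matrix (Fin n → d) (Fin n → d) ℂ := fun n =>
    specProj (tensorMat fun _ => V) fun w => ∏ k, b (w k) ≤ Real.exp (-(n * β))
  set Q : ∀ n : ℕ, (Fin n → p.prob.support) → Matrix (Fin n → d) (Fin n → d) ℂ := fun n y =>
    specProj (tensorMat fun k => U (y k)) fun w => Real.exp (-(n * α)) ≤ ∏ k, a (y k) (w k)
  have hP' : ∀ n, (1 - P n).PosSemidef := fun n => by
    rw [one_sub_specProj (hVn' n)]; exact specProj_posSemidef _ _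
  have hQ' : ∀ n y, (1 - Q n y).PosSemidef := fun n y => by
    rw [one_sub_specProj (hUn' n y)]; exact specProj_posSemidef _ _
  have hw0 : ∀ n (y : Fin n → p.prob.support), 0 ≤ ∏ k, p.prob (y k) := fun n y =>
    Finset.prod_nonneg fun k _ => p.nonneg _
  have hPlim : Filter.Tendsto (fun n => ((State.tensor fun _ : Fin n => W.avgState p).mat
      * (1 - P n)).trace.re) Filter.atTop (nhds 0) := by
    have hdev := tendsto_sum_large_deviation hb hb1 (Z := fun j => Real.log (b j)) (z := -β)
      (by rw [hβ]; linarith)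
    refine squeeze_zero (fun n => re_trace_mul_nonneg (State.posSemidef _) (hP' n)) (fun n => ?_)
      hdev
    rw [eσ, one_sub_specProj (hVn' n), trace_conjDiag_mul_specProj (hVn n)]
    refine Finset.sum_le_sum fun w _ => ?_
    have hnn : 0 ≤ ∏ k, b (w k) := Finset.prod_nonneg fun k _ => hb _
    by_cases h : ∏ k, b (w k) ≤ Real.exp (-(n * β))
    · rw [if_neg (not_not.2 h)]
      split_ifs <;> simp [hnn]
    · rw [if_pos h]
      push Not at h
      rw [if_pos]
      have hpos := (Real.exp_pos _).trans h
      rw [← Real.log_prod (Finset.prod_ne_zero_iff.1 hpos.ne'), Real.lt_log_iff_exp_lt hpos]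
      simpa using h
  have hQlim : Filter.Tendsto (fun n => ∑ y : Fin n → p.prob.support, (∏ k, p.prob (y k)) *
      ((W.memoryless n fun k => (y k : X)).mat * (1 - Q n y)).trace.re)
      Filter.atTop (nhds 0) := by
    have hdev := tendsto_sum_large_deviation (Ω := p.prob.support × d)
      (q := fun ω => p.prob ω.1 * a ω.1 ω.2) (Z := fun ω => -Real.log (a ω.1 ω.2)) (z := α)
      (fun ω => mul_nonneg (p.nonneg _) (ha _ _))
      (by
        rw [Fintype.sum_prod_type]
        simp only [← Finset.mul_sum, ha1, mul_one, p.sum_coe_eq_one])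
      (by
        rw [Fintype.sum_prod_type, hα]
        simp only [mul_neg, Finset.sum_neg_distrib, mul_assoc, ← Finset.mul_sum]
        linarith)
    refine squeeze_zero (fun n => Finset.sum_nonneg fun y _ => mul_nonneg (hw0 n y)
      (re_trace_mul_nonneg (State.posSemidef _) (hQ' n y))) (fun n => ?_) hdev
    -- A word of independent pairs (letter, eigenvalue index) is read as a pair of words.
    rw [← Fintype.sum_equiv (Equiv.arrowProdEquivProdArrow (Fin n) (fun _ => p.prob.support)
      (fun _ => d)).symm (fun yw => if n * α < ∑ k, -Real.log (a (yw.1 k) (yw.2 k)) then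
        ∏ k, p.prob (yw.1 k) * a (yw.1 k) (yw.2 k) else 0) _ (fun _ => rfl),
      Fintype.sum_prod_type]
    refine Finset.sum_le_sum fun y _ => ?_
    rw [eW, one_sub_specProj (hUn' n y), trace_conjDiag_mul_specProj (hUn n y), Finset.mul_sum]
    refine Finset.sum_le_sum fun w _ => ?_
    have hnn : 0 ≤ ∏ k, a (y k) (w k) := Finset.prod_nonneg fun k _ => ha _ _
    rw [Finset.prod_mul_distrib]
    by_cases h : Real.exp (-(n * α)) ≤ ∏ k, a (y k) (w k)
    · rw [if_neg (not_not.2 h), mul_zero]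
      split_ifs
      · exact mul_nonneg (hw0 n y) hnn
      · exact le_rfl
    · rw [if_pos h]
      push Not at h
      -- A vanishing product carries no weight, so the convention `log 0 = 0` does no harm to the
      -- event.
      rcases hnn.eq_or_lt with h0 | hpos
      · rw [← h0]; simp
      · rw [if_pos]
        rw [Finset.sum_neg_distrib, ← Real.log_prod (Finset.prod_ne_zero_iff.1 hpos.ne'), lt_neg]
        rwa [Real.log_lt_iff_lt_exp hpos]
  refine ⟨fun n y => P n * Q n y * P n, fun n y => sandwich_posSemidef (specProj_posSemidef _ _)
    (specProj_posSemidef _ _), fun n y => one_sub_sandwich_posSemidef (specProj_posSemidef _ _)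
    (specProj_mul_self (hVn n) _) (hP' n) (hQ' n y), fun n y => ?_, ?_⟩
  · rw [eσ]
    refine (trace_mul_typical_le (hUn n y) (hVn n) (hVn' n)
      (fun w => Finset.prod_nonneg fun k _ => ha _ _) ?_ (Real.exp_pos _)
      (Real.exp_nonneg _)).trans (le_of_eq ?_)
    · rw [← Fintype.prod_sum fun (k : Fin n) i => a (y k) i]
      simp [ha1]
    · rw [← Real.exp_sub, ← hαβ]
      ring_nf
  · have hlim := (hPlim.const_mul 3).add (hQlim.const_mul 2)
    rw [mul_zero, mul_zero, add_zero] at hlim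
    refine squeeze_zero (fun n => Finset.sum_nonneg fun y _ => mul_nonneg (hw0 n y)
      (re_trace_mul_nonneg (State.posSemidef _) (one_sub_sandwich_posSemidef
        (specProj_posSemidef _ _) (specProj_mul_self (hVn n) _) (hP' n) (hQ' n y))))
      (fun n => ?_) hlim
    rw [← W.sum_trace_memoryless_mul, Finset.mul_sum, Finset.mul_sum, ← Finset.sum_add_distrib]
    refine Finset.sum_le_sum fun y _ => ?_
    have := mul_le_mul_of_nonneg_left (trace_mul_one_sub_sandwich_le
      (State.posSemidef (W.memoryless n fun k => (y k : X))) (specProj_mul_self (hVn n) _) (hP' n)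
      (specProj_posSemidef _ _) (hQ' n y)) (hw0 n y)
    linarith

/-- Rates below the Holevo information of some input distribution are achievable. -/
theorem Channel.exists_codes (p : FinDist X) {r : ℝ} (hr : r < W.holevoInfo p) :
    ∃ c : ∀ n, Code (Fin n → X) (Fin n → d), (∀ n : ℕ, Real.exp (n * r) ≤ (c n).M) ∧
      Filter.Tendsto (fun n => (c n).avgError (W.memoryless n)) Filter.atTop (nhds 0) := by
  obtain ⟨r', hrr', hr'⟩ := exists_between hr
  obtain ⟨T, hT, hT', hTσ, hlim⟩ := W.exists_tests p hr'
  have hw1 : ∀ n, ∑ y : Fin n → p.prob.support, ∏ k, p.prob (y k) = 1 := fun n => by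
    rw [← Fintype.prod_sum fun (_ : Fin n) (x : p.prob.support) => p.prob x]
    simp only [p.sum_coe_eq_one, Finset.prod_const_one]
  have hM : ∀ n : ℕ, 0 < ⌈Real.exp (n * r)⌉₊ := fun n => Nat.ceil_pos.2 (Real.exp_pos _)
  choose c hcM hc using fun n => exists_code_of_average (W.memoryless n)
    (fun (y : Fin n → p.prob.support) k => (y k : X))
    (fun y => Finset.prod_nonneg fun k _ => p.nonneg _) (hw1 n) (T n) (hT n) (hT' n) le_rfl
    (fun y' => (W.sum_trace_memoryless_mul p n (T n y')).trans_le (hTσ n y'))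
    (Real.exp_pos (-(n : ℝ))) (hM n)
  refine ⟨c, fun n => by rw [hcM]; exact Nat.le_ceil _, ?_⟩
  have hexp : ∀ k : ℝ, 0 < k →
      Filter.Tendsto (fun n : ℕ => Real.exp (-(n * k))) Filter.atTop (nhds 0) := fun k hk =>
    Real.tendsto_exp_neg_atTop_nhds_zero.comp
      (tendsto_natCast_atTop_atTop.atTop_mul_const hk)
  have h := ((hlim.const_mul 2).add ((hexp (r' - r) (sub_pos.2 hrr')).const_mul 4)).add
    ((hexp 1 one_pos).const_mul 4)
  simp only [mul_zero, add_zero, mul_one] at h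
  refine squeeze_zero (fun n => (c n).avgError_nonneg _) (fun n => (hc n).trans ?_) h
  -- Only the `M - 1` other messages compete, which cancels the rounding up: `⌈x⌉ - 1 ≤ x`.
  have h1 : ((⌈Real.exp (n * r)⌉₊ : ℝ) - 1) * Real.exp (-(n * r'))
      ≤ Real.exp (-(n * (r' - r))) := by
    calc _ ≤ Real.exp (n * r) * Real.exp (-(n * r')) := by
          gcongr
          linarith [Nat.ceil_lt_add_one (Real.exp_nonneg (n * r))]
      _ = _ := by rw [← Real.exp_add]; ring_nf
  linarith

end Direct

/-! ### The capacities -/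

section Capacity

variable {X d : Type*} [Fintype d] [DecidableEq d] (W : Channel X d)

theorem capacity_le_strongConverseCapacity {Z e : ℕ → Type*} [∀ n, Fintype (e n)]
    [∀ n, DecidableEq (e n)] (V : ∀ n, Channel (Z n) (e n)) :
    capacity V ≤ strongConverseCapacity V := by
  refine sSup_le ?_
  rintro _ ⟨c, hc, rfl⟩
  refine le_sInf ?_
  rintro _ ⟨R, hR, rfl⟩
  by_contra hlt
  exact zero_ne_one (tendsto_nhds_unique hc (hR c (not_le.1 hlt).le))

theorem le_rate_iff {n M : ℕ} (hn : 0 < n) (hM : 0 < M) (z : ℝ) :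
    z ≤ 1 / (n : ℝ) * Real.logb 2 M ↔ Real.exp (n * (z * Real.log 2)) ≤ M := by
  have hn' : (0 : ℝ) < n := by exact_mod_cast hn
  have hM' : (0 : ℝ) < M := by exact_mod_cast hM
  rw [← Real.le_log_iff_exp_le hM', Real.logb, one_div, inv_mul_eq_div, le_div_iff₀ hn',
    le_div_iff₀ (Real.log_pos one_lt_two), mul_comm z, mul_assoc]

theorem Channel.holevoCapacity_le_capacity :
    W.holevoCapacity ≤ capacity fun n => W.memoryless n := by
  refine iSup_le fun p => ?_
  rw [W.holevoQuantity_eq, ← EReal.ge_of_forall_gt_iff_ge]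
  intro z hz
  rw [EReal.coe_lt_coe_iff, lt_div_iff₀ (Real.log_pos one_lt_two)] at hz
  obtain ⟨c, hcM, hc⟩ := W.exists_codes p hz
  refine le_trans ?_ (le_sSup ⟨c, hc, rfl⟩)
  refine Filter.le_liminf_of_le (by isBoundedDefault) ?_
  filter_upwards [Filter.eventually_gt_atTop 0] with n hn
  exact EReal.coe_le_coe_iff.2 ((le_rate_iff hn (c n).M_pos z).2 (hcM n))

theorem Channel.strongConverseCapacity_le_holevoCapacity [Nonempty X] :
    strongConverseCapacity (fun n => W.memoryless n) ≤ W.holevoCapacity := by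
  rw [← EReal.le_of_forall_lt_iff_le]
  intro z hz
  obtain ⟨z', hz', hzz'⟩ := EReal.lt_iff_exists_real_btwn.1 hz
  rw [EReal.coe_lt_coe_iff] at hzz'
  have hlog := Real.log_pos one_lt_two
  have hub : z' * Real.log 2 ∈ upperBounds (Set.range W.holevoInfo) := by
    rintro _ ⟨p, rfl⟩
    have h := (le_iSup W.holevoQuantity p).trans hz'.le
    rw [W.holevoQuantity_eq, EReal.coe_le_coe_iff, div_le_iff₀ hlog] at h
    exact h
  -- A point mass is an input distribution; together with the upper bound this makes the supremum a
  -- real number.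
  have hne : (Set.range W.holevoInfo).Nonempty :=
    ⟨_, ⟨⟨Finsupp.single (Classical.arbitrary X) 1,
      fun x => by classical rw [Finsupp.single_apply]; split_ifs <;> norm_num,
      by rw [Finsupp.support_single _ one_ne_zero]; simp⟩, rfl⟩⟩
  have hχ := isLUB_csSup hne ⟨_, hub⟩
  set χ := sSup (Set.range W.holevoInfo)
  have hle : χ ≤ z' * Real.log 2 := hχ.2 hub
  -- Six parts pay for the margin `6γ` of `tendsto_avgError_one`. The seventh is needed because a
  -- liminf at least `z` only gives rates eventually above `z - γ / log 2`.
  set γ := (z - z') * Real.log 2 / 7 with hγ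
  have hγ0 : 0 < γ := by have := sub_pos.2 hzz'; positivity
  refine sInf_le ⟨z, fun c hc => W.tendsto_avgError_one hχ hγ0 c ?_, rfl⟩
  have hlt : (((z - γ / Real.log 2 : ℝ)) : EReal) < codeRate c :=
    lt_of_lt_of_le (EReal.coe_lt_coe_iff.2 (sub_lt_self _ (by positivity))) hc
  filter_upwards [Filter.eventually_lt_of_lt_liminf hlt, Filter.eventually_gt_atTop 0] with n h hn
  have h2 := (le_rate_iff hn (c n).M_pos _).1 (EReal.coe_lt_coe_iff.1 h).le
  refine le_trans (Real.exp_le_exp.2 (mul_le_mul_of_nonneg_left ?_ n.cast_nonneg)) h2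
  rw [sub_mul, div_mul_cancel₀ _ hlog.ne']
  linarith

end Capacity

end CQ

theorem mainTheorem4 {X d : Type*} [Nonempty X] [Fintype d] [DecidableEq d]
    (W : CQ.Channel X d) :
    CQ.capacity (fun n => W.memoryless n) = CQ.strongConverseCapacity (fun n => W.memoryless n) ∧
      CQ.strongConverseCapacity (fun n => W.memoryless n) = W.holevoCapacity := by
  have h1 := CQ.capacity_le_strongConverseCapacity fun n => W.memoryless n
  have h2 := W.strongConverseCapacity_le_holevoCapacity
  have h3 := W.holevoCapacity_le_capacity
  exact ⟨le_antisymm h1 (h2.trans h3), le_antisymm h2 (h3.trans h1)⟩
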